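/- Let $\mathbb{F}_q$ be a finite field and let $\mathcal{M}_n$ be the set of monic polynomials of degree $n$ in $\mathbb{F}_q[T]$. For $f\in\mathbb{F}_q[T]$ nonzero let $\omega(f)$ be the number of distinct monic irreducible polynomials dividing $f$. For a partition $\lambda$ of $n$ let $X^{\lambda}$ be the irreducible character of the symmetric group $\mathfrak{S}_n$ attached to $\lambda$ (so that $X^{(n)}$ is the trivial character), and write $X^\lambda(\tau)$ for its value at permutations of cycle type $\tau$. If $f$ is squarefree of degree $n$ with distinct irreducible factors $P_1,\dots,P_k$, set $X^\lambda(f) := X^\lambda(\tau_f)$, where $\tau_f$ is the partition of $n$ with parts $\deg P_1,\dots,\deg P_k$; for all other $f$ set $X^\lambda(f) := 0$. Then there is a function $b$ on $\mathbb{F}_q[T]$ with $b(f)=0$ for every squarefree $f$ such that, for every $n$ and every $f\in\mathcal{M}_n$, $$ \omega(f) = H_n X^{(n)}(f) + \sum_{\lambda} (-1)^\nu \Big(\frac{1}{\lambda_2+\nu}-\frac{1}{\lambda_1+\nu+1}\Big) X^{(\lambda_1,\lambda_2,1^\nu)}(f) + b(f), $$ where $H_n = 1+\frac12+\cdots+\frac1n$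 and the sum is over all partitions $\lambda=(\lambda_1,\lambda_2,1^\nu)\vdash n$ with $\lambda_1\ge\lambda_2\geq 1$ and $\nu\geq 0$. -/

import Mathlib

open Polynomial

/-! ### Irreducible characters of the symmetric group -/

/-- The Young diagram of a partition: its rows have the lengths `l₁ ≥ l₂ ≥ …` of the parts. -/
noncomputable def Nat.Partition.diagram {n : ℕ} (l : n.Partition) : YoungDiagram :=
  YoungDiagram.ofRowLens (l.parts.sort (· ≥ ·)) (Multiset.pairwise_sort _ _).sortedGE

theorem YoungDiagram.card_cellsOfRowLens (w : List ℕ) :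
    (YoungDiagram.cellsOfRowLens w).card = w.sum := by
  induction w with
  | nil => rfl
  | cons a w ih =>
    rw [YoungDiagram.cellsOfRowLens, Finset.card_union_of_disjoint]
    · simp [ih]
    · rw [Finset.disjoint_left]
      rintro ⟨i, j⟩ h1 h2
      simp at h1 h2
      omega

theorem Nat.Partition.card_diagram {n : ℕ} (l : n.Partition) : l.diagram.cells.card = n := by
  have h : (l.parts.sort (· ≥ ·)).sum = n := by
    rw [← Multiset.sum_coe, Multiset.sort_eq, l.parts_sum]
  exact (YoungDiagram.card_cellsOfRowLens _).trans h

/-- A bijective filling of the boxes of the Young diagram of `l` by `Fin n`, recorded as the map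
sending each entry to the box `(row, column)` that holds it. The characters below do not depend on
which filling is used. -/
noncomputable def Nat.Partition.tableau {n : ℕ} (l : n.Partition) : Fin n ≃ l.diagram.cells :=
  (Finset.equivFinOfCardEq l.card_diagram).symm

/-- The sum of the permutations that preserve each row of the tableau. -/
noncomputable def Nat.Partition.rowSymmetrizer {n : ℕ} (l : n.Partition) :
    MonoidAlgebra ℂ (Equiv.Perm (Fin n)) :=
  ∑ g : Equiv.Perm (Fin n) with ∀ i, (l.tableau (g i)).1.1 = (l.tableau i).1.1,
    MonoidAlgebra.single g 1

/-- The signed sum of the permutations that preserve each column of the tableau. -/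
noncomputable def Nat.Partition.colAntisymmetrizer {n : ℕ} (l : n.Partition) :
    MonoidAlgebra ℂ (Equiv.Perm (Fin n)) :=
  ∑ g : Equiv.Perm (Fin n) with ∀ i, (l.tableau (g i)).1.2 = (l.tableau i).1.2,
    MonoidAlgebra.single g ((Equiv.Perm.sign g : ℤ) : ℂ)

/-- The irreducible representation of `𝔖ₙ` attached to the partition `l`: the left ideal of the
group algebra generated by the Young symmetrizer. -/
noncomputable abbrev Nat.Partition.specht {n : ℕ} (l : n.Partition) :
    Ideal (MonoidAlgebra ℂ (Equiv.Perm (Fin n))) :=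
  Ideal.span {l.rowSymmetrizer * l.colAntisymmetrizer}

/-- The irreducible character `X^l` of `𝔖ₙ`: the trace of left multiplication by a permutation on
the left ideal `l.specht`. -/
noncomputable def Nat.Partition.permChar {n : ℕ} (l : n.Partition) (g : Equiv.Perm (Fin n)) : ℂ :=
  LinearMap.trace ℂ l.specht
    (Representation.ofModule' (k := ℂ) (G := Equiv.Perm (Fin n)) l.specht g)

/-- Every partition of `n` is the cycle type (fixed points included) of a permutation. -/
theorem Nat.Partition.exists_perm {n : ℕ} (t : n.Partition) :
    ∃ g : Equiv.Perm (Fin n), g.partition.parts = t.parts := by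
  have hs : t.parts.filter (2 ≤ ·) + Multiset.replicate (t.parts.count 1) 1 = t.parts := by
    conv_rhs => rw [← Multiset.filter_add_not (2 ≤ ·) t.parts]
    congr 1
    rw [← Multiset.filter_eq']
    apply Multiset.filter_congr
    intro x hx
    have := t.parts_pos hx
    omega
  have hsum : (t.parts.filter (2 ≤ ·)).sum + t.parts.count 1 = n := by
    have := congrArg Multiset.sum hs
    simpa [t.parts_sum] using this
  obtain ⟨g, hg⟩ := (Equiv.Perm.exists_with_cycleType_iff (Fin n)
    (m := t.parts.filter (2 ≤ ·))).mpr ⟨by simp; omega, by simp⟩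
  refine ⟨g, ?_⟩
  rw [Equiv.Perm.parts_partition, ← Equiv.Perm.sum_cycleType, hg, Fintype.card_fin]
  have : n - (t.parts.filter (2 ≤ ·)).sum = t.parts.count 1 := by omega
  rw [this, hs]

/-- The value `X^l(t)` of the character `X^l` at any permutation of cycle type `t`. -/
noncomputable def Nat.Partition.typeChar {n : ℕ} (l t : n.Partition) : ℂ :=
  l.permChar t.exists_perm.choose

/-! ### Factorization types of polynomials -/

open Classical in
/-- The factorization type of a squarefree polynomial of degree `n`: the partition of `n` formed by
the degrees of its prime factors. -/
noncomputable def Polynomial.factorizationType {F : Type*} [Field F] {n : ℕ} (f : F[X])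
    (hf : f.natDegree = n ∧ Squarefree f) : n.Partition where
  parts := (UniqueFactorizationMonoid.normalizedFactors f).map natDegree
  parts_pos := by
    intro i hi
    obtain ⟨p, hp, rfl⟩ := Multiset.mem_map.mp hi
    exact (UniqueFactorizationMonoid.irreducible_of_normalized_factor p hp).natDegree_pos
  parts_sum := by
    rw [← natDegree_multiset_prod _ (UniqueFactorizationMonoid.zero_notMem_normalizedFactors f),
      ← hf.1]
    exact natDegree_eq_of_degree_eq (degree_eq_degree_of_associated
      (UniqueFactorizationMonoid.prod_normalizedFactors hf.2.ne_zero))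

open Classical in
/-- `X^l(f)` for a polynomial `f` and a partition `l` of `n`: the value of `X^l` at the
factorization type of `f` if `f` is squarefree of degree `n`, and `0` otherwise. -/
noncomputable def Nat.Partition.polyChar {F : Type*} [Field F] {n : ℕ} (l : n.Partition)
    (f : F[X]) : ℂ :=
  if hf : f.natDegree = n ∧ Squarefree f then l.typeChar (f.factorizationType hf) else 0

/-- `ω(f)`: the number of distinct monic irreducible polynomials dividing `f`. -/
noncomputable def Polynomial.omega {F : Type*} [Field F] (f : F[X]) : ℕ :=
  {P : F[X] | P.Monic ∧ Irreducible P ∧ P ∣ f}.ncard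

/-! ### The partitions `(l₁, l₂, 1^v)` -/

/-- The part `l_{i+1}` of the partition `l = (l₁ ≥ l₂ ≥ …)`, with value `0` past the last part. -/
def Nat.Partition.nthPart {n : ℕ} (l : n.Partition) (i : ℕ) : ℕ :=
  (l.parts.sort (· ≥ ·)).getD i 0

/-- The partitions `(l₁, l₂, 1^v)` of `n` with `l₂ ≥ 1` and `v ≥ 0`; here `v` is the number of
parts minus two. -/
def twoRowsOnes (n : ℕ) : Finset n.Partition :=
  {l : n.Partition | 1 ≤ l.nthPart 1 ∧
    l.parts = l.nthPart 0 ::ₘ l.nthPart 1 ::ₘ Multiset.replicate (l.parts.card - 2) 1}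

/-! For squarefree `f`, ω(f) is the number of cycles of a permutation `g` of cycle type τ_f, so the
theorem is the expansion of the class function "number of cycles" in irreducible characters; `b`
absorbs all other `f`.

The number of cycles is the sum over k of N_k(g), the number of k-cycles. In symmetric functions
k·N_k corresponds to p_k h_{n-k}. Newton's identity writes p_k through products e_i h_{k-i}, and Σ
(-1)^i e_i h_{N-i} = 0 for N ≥ 1 regroups the result into h_n plus signed copies of the functions
`twoRowsFun` (`mul_card_orb_eq`). Dividing by k, summing, and folding by the antisymmetry in `a` and
`c` yields the harmonic number and the differences of reciprocals (`card_parts_eq`). Here the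
product e_p h_q h_r, with sign (-1)^p, is the combinatorial count `signedCount`.

It remains to show that `twoRowsFun` is the trace on the left ideal of the Young symmetrizer of (a,
c+1, 1^v). Three facts suffice: `twoRowsFun` has square sum n! (`sum_twoRowsFun_sq`), so does the
trace (`sum_idealTrace_sq`), and their inner sum is at least n! (`sum_twoRowsFun_mul_idealTrace`).
The equality case of Cauchy–Schwarz then forces them to agree (`idealTrace_eq_of_inner`). -/

set_option linter.unusedSectionVars false

/-! ### Cycles of a permutation, and signs on the fibres of a map. -/

section Orbits

open Equiv Equiv.Perm Finset

variable {α : Type*} [Fintype α] [DecidableEq α]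

/-- The cycles of a permutation, fixed points included. -/
abbrev Equiv.Perm.Orb {α : Type*} (g : Perm α) : Type _ := Quotient (SameCycle.setoid g)

theorem Equiv.Perm.card_orb (g : Perm α) [Fintype g.Orb] :
    Fintype.card g.Orb = g.partition.parts.card := by
  classical
  -- The fibres of `f` are the cycles of `g`, and its image splits into the nontrivial cycles and
  -- the fixed points, as the parts of `partition` do.
  let f : α → Perm α ⊕ α := fun x => if g x = x then Sum.inr x else Sum.inl (g.cycleOf x)
  have hf : ∀ x y, f x = f y ↔ g.SameCycle x y := by
    intro x y
    by_cases hx : g x = x <;> by_cases hy : g y = y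
    · simp only [f, hx, hy, if_true, Sum.inr.injEq]
      exact ⟨fun h => h ▸ SameCycle.refl _ _, fun h => h.eq_of_left hx⟩
    · simp only [f, hx, hy, if_true, if_false, reduceCtorEq, false_iff]
      exact fun h => hy (h.apply_eq_self_iff.1 hx)
    · simp only [f, hx, hy, if_true, if_false, reduceCtorEq, false_iff]
      exact fun h => hx (h.apply_eq_self_iff.2 hy)
    · simp only [f, hx, hy, if_false, Sum.inl.injEq]
      refine ⟨fun h => ?_, fun h => h.cycleOf_eq⟩
      have h1 : x ∈ (g.cycleOf x).support := by
        rw [mem_support_cycleOf_iff]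
        exact ⟨SameCycle.refl _ _, by simpa using hx⟩
      rw [h, mem_support_cycleOf_iff] at h1
      exact h1.1.symm
  have h1 : univ.image f = g.cycleFactorsFinset.disjSum g.supportᶜ := by
    ext s
    rcases s with c | x
    · simp only [mem_image, mem_univ, true_and, inl_mem_disjSum]
      constructor
      · rintro ⟨x, hx⟩
        by_cases h : g x = x
        · simp [f, h] at hx
        · simp only [f, h, if_false, Sum.inl.injEq] at hx
          rw [← hx, cycleOf_mem_cycleFactorsFinset_iff]
          simpa using h
      · intro hc
        obtain ⟨x, hx⟩ := (mem_cycleFactorsFinset_iff.1 hc).1.nonempty_support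
        refine ⟨x, ?_⟩
        have := mem_cycleFactorsFinset_support_le hc hx
        rw [mem_support] at this
        simp only [f, this, if_false, Sum.inl.injEq]
        exact (cycle_is_cycleOf hx hc).symm
    · simp only [mem_image, mem_univ, true_and, inr_mem_disjSum, mem_compl, notMem_support]
      constructor
      · rintro ⟨y, hy⟩
        by_cases h : g y = y
        · simp only [f, h, if_true, Sum.inr.injEq] at hy
          exact hy ▸ h
        · simp [f, h] at hy
      · intro h
        exact ⟨x, by simp [f, h]⟩
  have h2 : Fintype.card g.Orb = (univ.image f).card := by
    let F : g.Orb → Perm α ⊕ α := Quotient.lift f (fun x y h => (hf x y).2 h)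
    have hF : Function.Injective F := by
      rintro ⟨x⟩ ⟨y⟩ h
      exact Quotient.sound ((hf x y).1 h)
    rw [← Finset.card_univ, ← Finset.card_image_of_injective univ hF]
    congr 1
    ext s
    simp only [mem_image, mem_univ, true_and]
    constructor
    · rintro ⟨⟨x⟩, hx⟩
      exact ⟨x, hx⟩
    · rintro ⟨x, hx⟩
      exact ⟨Quotient.mk _ x, hx⟩
  rw [h2, h1, card_disjSum, parts_partition, Multiset.card_add, Multiset.card_replicate,
    card_compl, cycleType_def, Multiset.card_map]
  rfl

theorem Equiv.Perm.sign_eq_card_orb (g : Perm α) [Fintype g.Orb] :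
    (sign g : ℤ) = (-1) ^ (Fintype.card α + Fintype.card g.Orb) := by
  rw [card_orb, sign_of_cycleType, parts_partition, Multiset.card_add, Multiset.card_replicate,
    sum_cycleType]
  have : g.support.card ≤ Fintype.card α := card_le_univ _
  obtain ⟨k, hk⟩ := Nat.exists_eq_add_of_le this
  rw [hk, Nat.add_sub_cancel_left]
  push_cast
  rw [show g.support.card + k + (g.cycleType.card + k)
    = (g.support.card + g.cycleType.card) + 2 * k by ring, pow_add _ _ (2 * k), pow_mul]
  simp

/-- The sign of the restriction of `g` to the fibre of `d` over `z` if `g` preserves the fibres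
of `d`, and `0` otherwise. -/
def sgnOn {ι : Type*} [DecidableEq ι] (z : ι) (d : α → ι) (g : Perm α) : ℤ :=
  if h : ∀ x, d (g x) = d x then
    (sign (g.subtypePerm (p := fun x => d x = z) fun x => by rw [h x]) : ℤ)
  else 0

variable {ι : Type*} [DecidableEq ι] {z : ι} {d : α → ι} {g h : Perm α}

theorem sgnOn_of_stable (hg : ∀ x, d (g x) = d x) :
    sgnOn z d g = sign (g.subtypePerm (p := fun x => d x = z) fun x => by rw [hg x]) :=
  dif_pos hg

theorem sgnOn_of_not_stable (hg : ¬ ∀ x, d (g x) = d x) : sgnOn z d g = 0 := dif_neg hg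

theorem sgnOn_mul (hg : ∀ x, d (g x) = d x) (h : Perm α) :
    sgnOn z d (g * h) = sgnOn z d g * sgnOn z d h := by
  by_cases hh : ∀ x, d (h x) = d x
  · have : ∀ x, d ((g * h) x) = d x := fun x => by rw [mul_apply, hg, hh]
    rw [sgnOn_of_stable hg, sgnOn_of_stable hh, sgnOn_of_stable this, ← Units.val_mul,
      ← Perm.sign_mul,
      subtypePerm_mul]
  · rw [sgnOn_of_not_stable hh, mul_zero, sgnOn_of_not_stable]
    intro H
    refine hh fun x => ?_
    rw [← H x, mul_apply, hg]

theorem sgnOn_mul_right (hh : ∀ x, d (h x) = d x) (g : Perm α) :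
    sgnOn z d (g * h) = sgnOn z d g * sgnOn z d h := by
  by_cases hg : ∀ x, d (g x) = d x
  · exact sgnOn_mul hg h
  · rw [sgnOn_of_not_stable hg, zero_mul, sgnOn_of_not_stable]
    intro H
    refine hg fun x => ?_
    have h1 := H (h.symm x)
    have h2 := hh (h.symm x)
    simp only [mul_apply, apply_symm_apply] at h1 h2
    rw [h1, h2]

theorem sgnOn_eq_sign (hg : ∀ x, d (g x) = d x) (hz : ∀ x, g x ≠ x → d x = z) :
    sgnOn z d g = sign g := by
  rw [sgnOn_of_stable hg, sign_subtypePerm _ _ hz]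

theorem sgnOn_eq_one (hg : ∀ x, d (g x) = d x) (hz : ∀ x, d x = z → g x = x) :
    sgnOn z d g = 1 := by
  rw [sgnOn_of_stable hg]
  have : g.subtypePerm (p := fun x => d x = z) (fun x => by rw [hg x]) = 1 := by
    ext x
    simp [hz x x.2]
  rw [this]
  simp

theorem stable_swap {u v : α} (huv : d u = d v) (x : α) : d (swap u v x) = d x := by
  rw [swap_apply_def]
  split_ifs with h1 h2
  · rw [h1, huv]
  · rw [h2, huv]
  · rfl

theorem sgnOn_swap_of_ne {u v : α} (huv : d u = d v) (hz : d u ≠ z) :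
    sgnOn z d (swap u v) = 1 := by
  refine sgnOn_eq_one (stable_swap huv) fun x hx => swap_apply_of_ne_of_ne ?_ ?_
  · rintro rfl
    exact hz hx
  · rintro rfl
    exact hz (huv.trans hx)

theorem sgnOn_swap_of_eq {u v : α} (hne : u ≠ v) (huv : d u = d v) (hz : d u = z) :
    sgnOn z d (swap u v) = -1 := by
  rw [sgnOn_eq_sign (stable_swap huv), sign_swap hne]
  · rfl
  · intro x hx
    by_contra h
    refine hx (swap_apply_of_ne_of_ne ?_ ?_)
    · rintro rfl
      exact h hz
    · rintro rfl
      exact h (huv ▸ hz)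

theorem sgnOn_sq (hg : ∀ x, d (g x) = d x) : sgnOn z d g * sgnOn z d g = 1 := by
  rw [sgnOn_of_stable hg, ← Units.val_mul, Int.units_mul_self, Units.val_one]

theorem sgnOn_comp (s : Perm α) : sgnOn z (d ∘ s) (s⁻¹ * g * s) = sgnOn z d g := by
  by_cases hg : ∀ x, d (g x) = d x
  · have : ∀ x, (d ∘ s) ((s⁻¹ * g * s) x) = (d ∘ s) x := fun x => by simp [hg]
    rw [sgnOn_of_stable hg, sgnOn_of_stable this]
    congr 1
    let e : {x // (d ∘ s) x = z} ≃ {x // d x = z} :=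
      s.subtypeEquiv fun x => Iff.rfl
    refine sign_eq_sign_of_equiv _ _ e fun x => ?_
    ext
    simp [e]
  · rw [sgnOn_of_not_stable hg, sgnOn_of_not_stable]
    intro H
    refine hg fun x => ?_
    simpa using H (s⁻¹ x)

-- A permutation of p points with t cycles has sign (-1)^(p+t), so the extra (-1)^p leaves one
-- factor -1 per cycle placed over `z`. This makes the signed count multiplicative over cycles.
open Classical in
theorem sgnOn_orb (g : Perm α) (e : g.Orb → ι) :
    (-1) ^ #{x | e (Quotient.mk _ x) = z} * sgnOn z (fun x => e (Quotient.mk _ x)) g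
      = ∏ o : g.Orb, if e o = z then (-1 : ℤ) else 1 := by
  have hst : ∀ x, e (Quotient.mk _ (g x)) = e (Quotient.mk _ x) := fun x => by
    congr 1
    exact Quotient.sound (sameCycle_apply_left.2 (SameCycle.refl g x))
  rw [sgnOn_of_stable hst, sign_eq_card_orb, ← Finset.prod_filter, Finset.prod_const,
    Fintype.card_subtype, ← pow_add, ← add_assoc, pow_add, ← two_mul, pow_mul]
  simp only [even_two, Even.neg_pow, one_pow, one_mul]
  congr 1
  rw [← Fintype.card_subtype]
  set p := g.subtypePerm (p := fun x => e (Quotient.mk _ x) = z) fun x => by rw [hst x]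
  let F : p.Orb → {o : g.Orb // e o = z} :=
    Quotient.lift (fun x => ⟨Quotient.mk _ x.1, x.2⟩) (by
      intro x y hxy
      refine Subtype.ext (Quotient.sound ?_)
      exact sameCycle_subtypePerm.1 hxy)
  refine Fintype.card_of_bijective (f := F) ⟨?_, ?_⟩
  · rintro ⟨x⟩ ⟨y⟩ h
    have : g.SameCycle x.1 y.1 := Quotient.exact (congrArg Subtype.val h)
    exact Quotient.sound (sameCycle_subtypePerm.2 this)
  · rintro ⟨⟨x⟩, hx⟩
    exact ⟨Quotient.mk _ ⟨x, hx⟩, rfl⟩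

-- A stable map is constant on cycles, hence factors uniquely through `g.Orb`.
open Classical in
theorem sum_stable {M : Type*} [AddCommMonoid M] [Fintype ι] (g : Perm α) (G : (α → ι) → M)
    (hG : ∀ d, ¬ (∀ x, d (g x) = d x) → G d = 0) :
    ∑ d, G d = ∑ e : g.Orb → ι, G fun x => e (Quotient.mk _ x) := by
  symm
  refine Finset.sum_of_injOn (fun e x => e (Quotient.mk _ x)) ?_ (by simp) ?_ (by simp)
  · intro e _ e' _ h
    funext o
    obtain ⟨x, rfl⟩ := Quotient.exists_rep o
    exact congrFun h x
  · intro d _ hd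
    refine hG d fun hst => hd ?_
    have : ∀ x y, g.SameCycle x y → d x = d y := by
      rintro x y ⟨i, rfl⟩
      have h1 : ∀ (m : ℕ) x, d ((g ^ m) x) = d x := by
        intro m
        induction m with
        | zero => simp
        | succ m ih => intro x; rw [pow_succ', mul_apply, hst, ih]
      obtain ⟨m, rfl | rfl⟩ := i.eq_nat_or_neg
      · simp [h1]
      · rw [← h1 m ((g ^ (-(m : ℤ))) x)]
        simp
    exact ⟨Quotient.lift d this, by simp, rfl⟩

open Classical in
/-- The size of an orbit. -/
noncomputable def orbSize (g : Perm α) (o : g.Orb) : ℕ :=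
  #{x : α | (Quotient.mk _ x : g.Orb) = o}

open Classical in
theorem card_fiber_orb (g : Perm α) (e : g.Orb → ι) (i : ι) :
    #{x | e (Quotient.mk _ x) = i} = ∑ o : g.Orb, if e o = i then orbSize g o else 0 := by
  rw [Finset.card_eq_sum_card_fiberwise (f := fun x => (Quotient.mk _ x : g.Orb)) (t := univ)
    (by simp)]
  refine Finset.sum_congr rfl fun o _ => ?_
  split_ifs with h
  · unfold orbSize
    congr 1
    ext x
    simp only [mem_filter, mem_univ, true_and, and_iff_right_iff_imp]
    rintro rfl
    exact h
  · rw [Finset.card_eq_zero, Finset.filter_eq_empty_iff]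
    intro x hx
    simp only [mem_filter, mem_univ, true_and] at hx
    rintro rfl
    exact h hx

open Classical in
theorem sum_orbSize (g : Perm α) : ∑ o, orbSize g o = Fintype.card α := by
  have := card_fiber_orb g (fun _ => ()) ()
  simpa using this.symm

theorem orbSize_pos (g : Perm α) (o : g.Orb) : 0 < orbSize g o := by
  classical
  obtain ⟨x, rfl⟩ := Quotient.exists_rep o
  exact Finset.card_pos.2 ⟨x, by simp⟩

end Orbits

/-! ### Signed counts of stable decompositions, and the expansion of the number of cycles. -/

section SignedCounts

open Equiv Equiv.Perm Finset

variable {α : Type*} [Fintype α] [DecidableEq α]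

theorem sgnOn_comp_left {ι : Type*} [DecidableEq ι] {z : ι} (s : Perm ι) (hs : s z = z)
    (d : α → ι) (g : Perm α) : sgnOn z (s ∘ d) g = sgnOn z d g := by
  by_cases hg : ∀ x, d (g x) = d x
  · have : ∀ x, (s ∘ d) (g x) = (s ∘ d) x := fun x => by simp [hg]
    rw [sgnOn_of_stable hg, sgnOn_of_stable this]
    congr 1
    have key : ∀ x, (s ∘ d) x = z ↔ d x = z := fun x => by
      rw [Function.comp_apply, ← hs, s.injective.eq_iff, hs]
    let e : {x // (s ∘ d) x = z} ≃ {x // d x = z} := (Equiv.refl α).subtypeEquiv key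
    exact sign_eq_sign_of_equiv _ _ e fun x => rfl
  · rw [sgnOn_of_not_stable hg, sgnOn_of_not_stable]
    exact fun H => hg fun x => s.injective (H x)

/-- The sizes of the fibres of a map. -/
def fiberSize {ι : Type*} [DecidableEq ι] (d : α → ι) (i : ι) : ℕ := #{x | d x = i}

theorem sum_fiberSize {ι : Type*} [DecidableEq ι] [Fintype ι] (d : α → ι) :
    ∑ i, fiberSize d i = Fintype.card α :=
  (Finset.card_eq_sum_card_fiberwise (by simp)).symm

theorem fiberSize_three (d : α → Fin 3) :
    fiberSize d 0 + fiberSize d 1 + fiberSize d 2 = Fintype.card α := by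
  rw [← sum_fiberSize d, Fin.sum_univ_three]

/-- The signed number of `g`-stable ordered decompositions into parts of sizes `p`, `q`, `r`; a
decomposition counts with `(-1) ^ p` times the sign of `g` on the part of size `p`. -/
def signedCount (g : Perm α) (p q r : ℕ) : ℤ :=
  ∑ d : α → Fin 3 with fiberSize d 0 = p ∧ fiberSize d 1 = q ∧ fiberSize d 2 = r,
    (-1) ^ p * sgnOn 0 d g

theorem signedCount_symm (g : Perm α) (p q r : ℕ) :
    signedCount g p q r = signedCount g p r q := by
  have hs : ∀ (d : α → Fin 3) i, fiberSize (swap 1 2 ∘ d) i = fiberSize d (swap 1 2 i) := by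
    intro d i
    unfold fiberSize
    congr 1
    ext x
    simp [← Equiv.eq_symm_apply]
  unfold signedCount
  refine Finset.sum_nbij' (fun d => swap 1 2 ∘ d) (fun d => swap 1 2 ∘ d) ?_ ?_ ?_ ?_ ?_
  · intro d
    simp only [mem_filter, mem_univ, true_and, hs]
    rintro ⟨h0, h1, h2⟩
    exact ⟨by rwa [swap_apply_of_ne_of_ne (by decide) (by decide)], by simpa using h2,
      by simpa using h1⟩
  · intro d
    simp only [mem_filter, mem_univ, true_and, hs]
    rintro ⟨h0, h1, h2⟩
    exact ⟨by rwa [swap_apply_of_ne_of_ne (by decide) (by decide)], by simpa using h2,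
      by simpa using h1⟩
  · intro d _
    funext x
    simp
  · intro d _
    funext x
    simp
  · intro d _
    rw [sgnOn_comp_left _ (swap_apply_of_ne_of_ne (by decide) (by decide))]

/-- The contribution of one cycle of length `l`, placed in part `i`. -/
noncomputable def orbWeight (l : ℕ) (i : Fin 3) : ℤ[X] :=
  if i = 0 then -1 else if i = 2 then X ^ l else 1

open Classical in
theorem orbWeight_prod (g : Perm α) (e : g.Orb → Fin 3) :
    C ((-1) ^ fiberSize (fun x => e (Quotient.mk _ x)) 0
        * sgnOn 0 (fun x => e (Quotient.mk _ x)) g)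
      * X ^ fiberSize (fun x => e (Quotient.mk _ x)) 2
      = ∏ o, orbWeight (orbSize g o) (e o) := by
  unfold fiberSize
  have h0 := sgnOn_orb g e (z := 0)
  have h2 := card_fiber_orb g e 2
  rw [h0, h2, ← Finset.prod_pow_eq_pow_sum, map_prod, ← Finset.prod_mul_distrib]
  refine Finset.prod_congr rfl fun o _ => ?_
  unfold orbWeight
  generalize e o = i
  fin_cases i <;> simp

-- The sum factors over cycles, and a cycle of length l contributes -1 + 1 + X^l = X^l.
open Classical in
theorem sum_signed_X_pow (g : Perm α) :
    ∑ d : α → Fin 3, C ((-1) ^ fiberSize d 0 * sgnOn 0 d g) * (X : ℤ[X]) ^ fiberSize d 2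
      = X ^ Fintype.card α := by
  rw [sum_stable g _ (fun d hd => by rw [sgnOn_of_not_stable hd]; simp)]
  simp_rw [orbWeight_prod]
  have := Finset.prod_univ_sum (fun _ : g.Orb => (univ : Finset (Fin 3)))
    (fun o i => orbWeight (orbSize g o) i)
  rw [Fintype.piFinset_univ] at this
  rw [← this, ← sum_orbSize g, ← Finset.prod_pow_eq_pow_sum]
  refine Finset.prod_congr rfl fun o _ => ?_
  simp [Fin.sum_univ_three, orbWeight]

-- The factor `fiberSize d 1` amounts to marking a cycle inside part 1. The marked cycle contributes
-- its size, every other one X^l as in `sum_signed_X_pow`.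
open Classical in
theorem sum_signed_card_X_pow (g : Perm α) :
    ∑ d : α → Fin 3, C ((fiberSize d 1 : ℤ) * ((-1) ^ fiberSize d 0 * sgnOn 0 d g))
        * (X : ℤ[X]) ^ fiberSize d 2
      = ∑ o, C (orbSize g o : ℤ) * X ^ (Fintype.card α - orbSize g o) := by
  rw [sum_stable g _ (fun d hd => by rw [sgnOn_of_not_stable hd]; simp)]
  simp_rw [map_mul C (_ : ℤ) (_ * _), mul_assoc (C _) (C _), orbWeight_prod]
  have h1 : ∀ e : g.Orb → Fin 3, fiberSize (fun x => e (Quotient.mk _ x)) 1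
      = ∑ o, if e o = 1 then orbSize g o else 0 := fun e => card_fiber_orb g e 1
  simp_rw [h1, Nat.cast_sum, map_sum, Finset.sum_mul]
  rw [Finset.sum_comm]
  refine Finset.sum_congr rfl fun o₀ _ => ?_
  have h2 : ∀ e : g.Orb → Fin 3,
      C (((if e o₀ = 1 then orbSize g o₀ else 0 : ℕ) : ℤ)) * ∏ o, orbWeight (orbSize g o) (e o)
      = C (orbSize g o₀ : ℤ) * ∏ o, (if o = o₀ then (if e o = 1 then 1 else 0)
          else orbWeight (orbSize g o) (e o)) := by
    intro e
    rw [← Finset.mul_prod_erase univ _ (mem_univ o₀), ← Finset.mul_prod_erase univ _ (mem_univ o₀)]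
    rw [Finset.prod_congr rfl (g := fun o => orbWeight (orbSize g o) (e o))
      (s₁ := univ.erase o₀) (fun o ho => if_neg (Finset.ne_of_mem_erase ho))]
    by_cases h : e o₀ = 1 <;> simp [h, orbWeight]
  simp_rw [h2]
  rw [← Finset.mul_sum]
  congr 1
  have := Finset.prod_univ_sum (fun _ : g.Orb => (univ : Finset (Fin 3)))
    (fun o i => if o = o₀ then (if i = 1 then 1 else 0) else orbWeight (orbSize g o) i)
  rw [Fintype.piFinset_univ] at this
  rw [← this, ← Finset.mul_prod_erase univ _ (mem_univ o₀)]
  have h3 : Fintype.card α - orbSize g o₀ = ∑ o ∈ univ.erase o₀, orbSize g o := by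
    rw [← sum_orbSize g, ← Finset.add_sum_erase univ _ (mem_univ o₀), Nat.add_sub_cancel_left]
  rw [h3, ← Finset.prod_pow_eq_pow_sum, Fin.sum_univ_three]
  simp only [if_true]
  rw [show (if (0 : Fin 3) = 1 then (1 : ℤ[X]) else 0) + 1 + (if (2 : Fin 3) = 1 then 1 else 0) = 1
    by simp, one_mul]
  refine Finset.prod_congr rfl fun o ho => ?_
  simp [Fin.sum_univ_three, orbWeight, Finset.ne_of_mem_erase ho]

theorem sum_signedCount (g : Perm α) {N r : ℕ} (hN : N + r = Fintype.card α) (w : ℕ → ℤ) :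
    ∑ i ∈ range (N + 1), w (N - i) * signedCount g i (N - i) r
      = ∑ d : α → Fin 3 with fiberSize d 2 = r,
          w (fiberSize d 1) * ((-1) ^ fiberSize d 0 * sgnOn 0 d g) := by
  rw [← Finset.sum_fiberwise_of_maps_to (t := range (N + 1)) (g := fun d => fiberSize d 0)]
  · refine Finset.sum_congr rfl fun i hi => ?_
    unfold signedCount
    rw [Finset.mul_sum, Finset.filter_filter]
    have hi' : i ≤ N := Nat.lt_succ_iff.1 (mem_range.1 hi)
    have : ∀ d : α → Fin 3, (fiberSize d 0 = i ∧ fiberSize d 1 = N - i ∧ fiberSize d 2 = r)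
        ↔ (fiberSize d 2 = r ∧ fiberSize d 0 = i) := by
      intro d
      have := fiberSize_three d
      omega
    simp_rw [this]
    refine Finset.sum_congr rfl fun d hd => ?_
    have hd' := (mem_filter.1 hd).2
    have := fiberSize_three d
    rw [hd'.2, show fiberSize d 1 = N - i by omega]
  · intro d hd
    have hd' := (mem_filter.1 hd).2
    have := fiberSize_three d
    rw [mem_range]
    omega

/-- The relation Σ (-1)^i e_i h_{N-i} = 0 for N ≥ 1, multiplied by h_r: the coefficient of X^r in
`sum_signed_X_pow`. -/
theorem sum_signedCount_eq (g : Perm α) {N r : ℕ} (hN : N + r = Fintype.card α) :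
    ∑ i ∈ range (N + 1), signedCount g i (N - i) r = if N = 0 then 1 else 0 := by
  have h := sum_signedCount g hN fun _ => 1
  simp only [one_mul] at h
  rw [h, Finset.sum_filter]
  have h2 := congrArg (fun P => coeff P r) (sum_signed_X_pow g)
  simp only [finsetSum_coeff, coeff_C_mul, coeff_X_pow, mul_ite, mul_one, mul_zero] at h2
  simp_rw [eq_comm (a := r)] at h2
  rw [h2]
  exact if_congr (by omega) rfl rfl

-- Newton's identity Σ (-1)^i (k-i) e_i h_{k-i} = p_k, multiplied by h_m: the coefficient of X^m in
-- `sum_signed_card_X_pow`.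
open Classical in
theorem sum_mul_signedCount_eq (g : Perm α) {k m : ℕ} (hk : k + m = Fintype.card α) :
    ∑ i ∈ range (k + 1), ((k - i : ℕ) : ℤ) * signedCount g i (k - i) m
      = k * #{o : g.Orb | orbSize g o = k} := by
  have h := sum_signedCount g hk fun j => (j : ℤ)
  rw [h, Finset.sum_filter]
  have h2 := congrArg (fun P => coeff P m) (sum_signed_card_X_pow g)
  simp only [finsetSum_coeff, coeff_C_mul, coeff_X_pow, mul_ite, mul_one, mul_zero] at h2
  simp_rw [eq_comm (a := m)] at h2
  rw [h2, Finset.card_filter, Nat.cast_sum, Finset.mul_sum]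
  refine Finset.sum_congr rfl fun o _ => ?_
  have : orbSize g o ≤ Fintype.card α := by
    rw [← sum_orbSize g]
    exact Finset.single_le_sum (f := orbSize g) (by simp) (mem_univ o)
  by_cases h : orbSize g o = k
  · rw [if_pos (by omega), if_pos h, h]; simp
  · rw [if_neg (by omega), if_neg h]; simp

/-- The class function `F` that will turn out to be the character of `(a, c + 1, 1 ^ v)`. -/
def twoRowsFun (g : Perm α) (a c v : ℕ) : ℤ :=
  (-1) ^ (v + 1) * ∑ i ∈ range (v + 2),
    (signedCount g i (a + v + 1 - i) c - signedCount g i (c + v + 1 - i) a)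

/-- Used to straighten the terms with c ≥ a, which do not come from partitions. -/
theorem twoRowsFun_antisymm (g : Perm α) (a c v : ℕ) :
    twoRowsFun g c a v = - twoRowsFun g a c v := by
  unfold twoRowsFun
  rw [← mul_neg, ← Finset.sum_neg_distrib]
  simp

theorem sum_triangle {M : Type*} [AddCommMonoid M] (k : ℕ) (f : ℕ → ℕ → M) :
    ∑ c ∈ range (k + 1), ∑ i ∈ range (k - c + 1), f c i
      = ∑ s ∈ range (k + 1), ∑ i ∈ range (s + 1), f (s - i) i := by
  rw [Finset.sum_sigma', Finset.sum_sigma']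
  refine Finset.sum_nbij' (fun x => ⟨x.1 + x.2, x.2⟩) (fun x => ⟨x.1 - x.2, x.2⟩) ?_ ?_ ?_ ?_ ?_
  · rintro ⟨c, i⟩ h
    simp only [mem_sigma, mem_range] at h ⊢
    omega
  · rintro ⟨c, i⟩ h
    simp only [mem_sigma, mem_range] at h ⊢
    omega
  · rintro ⟨c, i⟩ h
    simp
  · rintro ⟨c, i⟩ h
    simp only [mem_sigma, mem_range] at h
    simp only [Sigma.mk.injEq, heq_eq_eq, and_true]
    omega
  · rintro ⟨c, i⟩ h
    simp

theorem sum_triangle_const {M : Type*} [AddCommMonoid M] (k : ℕ) (f : ℕ → M) :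
    ∑ c ∈ range (k + 1), ∑ i ∈ range (k - c + 1), f i
      = ∑ i ∈ range (k + 1), (k - i + 1) • f i := by
  rw [Finset.sum_comm' (t' := range (k + 1)) (s' := fun i => range (k - i + 1))]
  · simp
  · intro x y
    simp only [mem_range]
    omega

-- In the sum over `c` and `i`, the first signed counts are regrouped along the diagonals c + i = s:
-- those with s ≥ 1 vanish by `sum_signedCount_eq`, and s = 0 gives 1. In the second ones the sum
-- over `c` yields the weight k - i + 1, so that Newton's identity gives k times the number of
-- k-cycles, the surplus 1 contributing zero.
open Classical in
theorem mul_card_orb_eq (g : Perm α) {k m : ℕ} (hk : 1 ≤ k) (hkm : k + m = Fintype.card α) :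
    (k : ℤ) * #{o : g.Orb | orbSize g o = k}
      = 1 + ∑ c ∈ range k, (-1) ^ (k - 1 - c) * twoRowsFun g m c (k - 1 - c) := by
  have h1 : ∀ c ∈ range k, (-1) ^ (k - 1 - c) * twoRowsFun g m c (k - 1 - c)
      = - ∑ i ∈ range (k - c + 1),
          (signedCount g i (m + k - c - i) c - signedCount g i (k - i) m) := by
    intro c hc
    rw [mem_range] at hc
    unfold twoRowsFun
    rw [← mul_assoc, ← pow_add, show k - 1 - c + (k - 1 - c + 1) = 2 * (k - 1 - c) + 1 by ring,
      pow_succ, pow_mul]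
    simp only [even_two, Even.neg_pow, one_pow, mul_neg, mul_one, neg_mul, one_mul, neg_inj]
    rw [show k - 1 - c + 2 = k - c + 1 by omega]
    refine Finset.sum_congr rfl fun i hi => ?_
    rw [mem_range] at hi
    rw [show m + (k - 1 - c) + 1 - i = m + k - c - i by omega,
      show c + (k - 1 - c) + 1 - i = k - i by omega]
  -- The term c = k, added to complete the triangle, is zero by symmetry.
  have h2 : ∑ c ∈ range k, ∑ i ∈ range (k - c + 1),
        (signedCount g i (m + k - c - i) c - signedCount g i (k - i) m)
      = ∑ c ∈ range (k + 1), ∑ i ∈ range (k - c + 1),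
        (signedCount g i (m + k - c - i) c - signedCount g i (k - i) m) := by
    rw [Finset.sum_range_succ _ k]
    simp [signedCount_symm g 0 m k]
  rw [Finset.sum_congr rfl h1, Finset.sum_neg_distrib, h2]
  simp_rw [Finset.sum_sub_distrib]
  rw [sum_triangle, sum_triangle_const, Finset.sum_range_succ']
  have h3 : ∀ s ∈ range k, ∑ i ∈ range (s + 1 + 1),
      signedCount g i (m + k - (s + 1 - i) - i) (s + 1 - i) = 0 := by
    intro s hs
    rw [mem_range] at hs
    have := sum_signedCount_eq g (N := s + 1) (r := m + k - (s + 1)) (by omega)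
    simp only [Nat.add_eq_zero_iff, one_ne_zero, and_false, if_false] at this
    rw [← this]
    refine Finset.sum_congr rfl fun i hi => ?_
    rw [mem_range] at hi
    rw [signedCount_symm, show m + k - (s + 1 - i) - i = m + k - (s + 1) by omega]
  rw [Finset.sum_eq_zero h3]
  have h4 := sum_signedCount_eq g (N := 0) (r := k + m) (by omega)
  simp only [zero_add, range_one, sum_singleton, Nat.sub_zero, if_true] at h4
  simp only [zero_add, range_one, sum_singleton, Nat.sub_zero]
  rw [signedCount_symm, add_comm m k, h4, ← sum_mul_signedCount_eq g hkm]
  have h5 := sum_signedCount_eq g hkm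
  rw [if_neg (by omega)] at h5
  simp only [nsmul_eq_mul, Nat.cast_add, Nat.cast_one, add_mul, one_mul, Finset.sum_add_distrib]
  rw [h5]
  ring

/-- The triples `(a, c, v)` with `a + c + v + 1 = n`. -/
def triples (n : ℕ) : Finset (ℕ × ℕ × ℕ) :=
  {t ∈ range n ×ˢ range n ×ˢ range n | t.1 + t.2.1 + t.2.2 + 1 = n}

theorem mem_triples {n : ℕ} {t : ℕ × ℕ × ℕ} :
    t ∈ triples n ↔ t.1 + t.2.1 + t.2.2 + 1 = n := by
  simp only [triples, mem_filter, mem_product, mem_range, and_iff_right_iff_imp]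
  omega

/-- The cycles are counted by length k = c + v + 1, using `mul_card_orb_eq` divided by k. Terms with
c = a vanish, and those with c > a are reflected onto c < a with a change of sign, which produces
the second reciprocal. -/
theorem card_parts_eq (g : Perm α) {n : ℕ} (hn : Fintype.card α = n) :
    (g.partition.parts.card : ℚ) = harmonic n
      + ∑ t ∈ triples n with t.2.1 < t.1,
          (-1 : ℚ) ^ t.2.2 * (1 / (t.2.1 + 1 + t.2.2) - 1 / (t.1 + t.2.2 + 1))
            * twoRowsFun g t.1 t.2.1 t.2.2 := by
  classical
  subst hn
  set n := Fintype.card α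
  have h1 : (g.partition.parts.card : ℚ)
      = ∑ k ∈ range n, (#{o : g.Orb | orbSize g o = k + 1} : ℚ) := by
    rw [← card_orb, ← Finset.card_univ, ← Nat.cast_sum]
    congr 1
    rw [Finset.card_eq_sum_card_fiberwise (f := fun o => orbSize g o - 1) (t := range n)]
    · refine Finset.sum_congr rfl fun k _ => ?_
      congr 1
      ext o
      have := orbSize_pos g o
      simp only [mem_filter, mem_univ, true_and]
      omega
    · intro o _
      have h1 := orbSize_pos g o
      have : orbSize g o ≤ n :=
        (Finset.single_le_sum (f := orbSize g) (by simp) (mem_univ o)).trans_eq (sum_orbSize g)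
      simp only [coe_range, Set.mem_Iio]
      omega
  have h2 : ∀ k ∈ range n, (#{o : g.Orb | orbSize g o = k + 1} : ℚ) = ((k + 1 : ℕ) : ℚ)⁻¹
      + ∑ c ∈ range (k + 1),
        (-1) ^ (k - c) / ((k + 1 : ℕ) : ℚ) * twoRowsFun g (n - (k + 1)) c (k - c) := by
    intro k hk
    rw [mem_range] at hk
    have := congrArg (Int.cast (R := ℚ))
      (mul_card_orb_eq g (k := k + 1) (m := n - (k + 1)) (by omega) (by omega))
    push_cast at this
    have hk0 : ((k : ℚ) + 1) ≠ 0 := by positivity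
    push_cast
    rw [eq_comm, ← mul_right_inj' hk0, this, mul_add, mul_inv_cancel₀ hk0, Finset.mul_sum]
    congr 1
    refine Finset.sum_congr rfl fun c _ => ?_
    field_simp
  rw [h1, Finset.sum_congr rfl h2, Finset.sum_add_distrib]
  congr 1
  have h3 : ∑ k ∈ range n, ∑ c ∈ range (k + 1),
        (-1) ^ (k - c) / ((k + 1 : ℕ) : ℚ) * twoRowsFun g (n - (k + 1)) c (k - c)
      = ∑ t ∈ triples n, (-1 : ℚ) ^ t.2.2 / (t.2.1 + 1 + t.2.2) * twoRowsFun g t.1 t.2.1 t.2.2 := by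
    rw [Finset.sum_sigma']
    refine Finset.sum_nbij' (fun x => (n - (x.1 + 1), x.2, x.1 - x.2))
      (fun t => ⟨t.2.1 + t.2.2, t.2.1⟩) ?_ ?_ ?_ ?_ ?_
    · rintro ⟨k, c⟩ h
      simp only [mem_sigma, mem_range] at h
      rw [mem_triples]
      dsimp only
      omega
    · rintro ⟨a, c, v⟩ h
      rw [mem_triples] at h
      simp only [mem_sigma, mem_range] at h ⊢
      omega
    · rintro ⟨k, c⟩ h
      simp only [mem_sigma, mem_range] at h
      simp only [Sigma.mk.injEq, heq_eq_eq, and_true]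
      omega
    · rintro ⟨a, c, v⟩ h
      rw [mem_triples] at h
      dsimp only at h ⊢
      rw [Prod.mk.injEq, Prod.mk.injEq]
      omega
    · rintro ⟨k, c⟩ h
      simp only [mem_sigma, mem_range] at h
      have : ((k - c : ℕ) : ℚ) = k - c := by rw [Nat.cast_sub (by omega)]
      dsimp only
      rw [this]
      push_cast
      congr 2
      ring
  rw [h3, ← Finset.sum_filter_add_sum_filter_not (triples n) (fun t => t.2.1 < t.1),
    ← Finset.sum_filter_add_sum_filter_not ((triples n).filter fun t => ¬ t.2.1 < t.1)
      (fun t => t.2.1 = t.1), Finset.filter_filter, Finset.filter_filter]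
  have h4 : ∑ t ∈ triples n with ¬ t.2.1 < t.1 ∧ t.2.1 = t.1,
      (-1 : ℚ) ^ t.2.2 / (t.2.1 + 1 + t.2.2) * twoRowsFun g t.1 t.2.1 t.2.2 = 0 := by
    refine Finset.sum_eq_zero ?_
    rintro ⟨a, c, v⟩ h
    have hac : c = a := (mem_filter.1 h).2.2
    have := twoRowsFun_antisymm g a a v
    have h0 : twoRowsFun g a a v = 0 := by omega
    subst hac
    simp [h0]
  have h5 : ∑ t ∈ triples n with ¬ t.2.1 < t.1 ∧ ¬ t.2.1 = t.1,
      (-1 : ℚ) ^ t.2.2 / (t.2.1 + 1 + t.2.2) * twoRowsFun g t.1 t.2.1 t.2.2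
      = ∑ t ∈ triples n with t.2.1 < t.1,
        - ((-1 : ℚ) ^ t.2.2 / (t.1 + 1 + t.2.2) * twoRowsFun g t.1 t.2.1 t.2.2) := by
    refine Finset.sum_nbij' (fun t => (t.2.1, t.1, t.2.2)) (fun t => (t.2.1, t.1, t.2.2))
      ?_ ?_ ?_ ?_ ?_
    · rintro ⟨a, c, v⟩
      simp only [mem_filter, mem_triples]
      omega
    · rintro ⟨a, c, v⟩
      simp only [mem_filter, mem_triples]
      omega
    · simp
    · simp
    · rintro ⟨a, c, v⟩ _
      dsimp only
      rw [twoRowsFun_antisymm g a c v]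
      push_cast
      ring
  rw [h4, h5, zero_add, ← Finset.sum_add_distrib]
  refine Finset.sum_congr rfl fun t _ => ?_
  rw [show (t.1 : ℚ) + t.2.2 + 1 = t.1 + 1 + t.2.2 by ring]
  ring

end SignedCounts

/-! ### Inner products of signed counts, and the norm of `twoRowsFun`. -/

section Orthogonality

open Equiv Equiv.Perm Finset

variable {α : Type*} [Fintype α] [DecidableEq α]

theorem exists_fiberSize_eq {β : Type*} [Fintype β] [DecidableEq β] (N : β → ℕ)
    (hN : ∑ i, N i = Fintype.card α) : ∃ f : α → β, fiberSize f = N := by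
  have hc : Fintype.card α = Fintype.card (Σ i, Fin (N i)) := by simp [hN]
  obtain ⟨e⟩ := Fintype.card_eq.1 hc
  refine ⟨fun x => (e x).1, funext fun i => ?_⟩
  unfold fiberSize
  rw [← Fintype.card_subtype]
  have e1 : {x // (e x).1 = i} ≃ {y : Σ i, Fin (N i) // y.1 = i} :=
    e.subtypeEquiv fun x => Iff.rfl
  rw [Fintype.card_congr (e1.trans (Equiv.sigmaSubtype i))]
  simp

theorem exists_perm_comp_eq {β : Type*} [DecidableEq β] {f f' : α → β}
    (h : fiberSize f = fiberSize f') : ∃ s : Perm α, ∀ x, f (s x) = f' x := by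
  have : ∀ i, Nonempty ({x // f' x = i} ≃ {x // f x = i}) := fun i => by
    rw [← Fintype.card_eq, Fintype.card_subtype, Fintype.card_subtype]
    exact (congrFun h i).symm
  exact ⟨Equiv.ofFiberEquiv fun i => (this i).some,
    fun x => Equiv.ofFiberEquiv_map (fun i => (this i).some) x⟩

/-- Orbit-stabilizer: the maps with fibre sizes `N` form a single orbit of the symmetric group. -/
theorem sum_card_stabilizer {β : Type*} [Fintype β] [DecidableEq β] (N : β → ℕ)
    (hN : ∑ i, N i = Fintype.card α) :
    ∑ f : α → β with fiberSize f = N, #{g : Perm α | ∀ x, f (g x) = f x}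
      = (Fintype.card α).factorial := by
  obtain ⟨f₀, hf₀⟩ := exists_fiberSize_eq N hN
  have h1 : ∀ f ∈ univ.filter (fun f : α → β => fiberSize f = N),
      #{g : Perm α | ∀ x, f (g x) = f x} = #{g : Perm α | f₀ ∘ g = f} := by
    intro f hf
    obtain ⟨s, hs⟩ := exists_perm_comp_eq (hf₀.trans (mem_filter.1 hf).2.symm)
    refine Finset.card_nbij' (fun g => s * g) (fun g => s⁻¹ * g) ?_ ?_ ?_ ?_
    · intro g hg
      simp only [coe_filter, mem_univ, true_and, Set.mem_ofPred_eq] at hg ⊢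
      funext x
      simp [hs, hg]
    · intro g hg
      simp only [coe_filter, mem_univ, true_and, Set.mem_ofPred_eq] at hg ⊢
      intro x
      rw [← hs, ← congrFun hg x]
      simp
    · intro g _
      simp
    · intro g _
      simp
  rw [Finset.sum_congr rfl h1, ← Fintype.card_perm, ← Finset.card_univ]
  refine (Finset.card_eq_sum_card_fiberwise (f := fun g : Perm α => f₀ ∘ g) ?_).symm
  intro g _
  simp only [coe_filter, mem_univ, true_and, Set.mem_ofPred_eq]
  rw [← hf₀]
  funext i
  unfold fiberSize
  refine Finset.card_nbij' g g.symm ?_ ?_ ?_ ?_ <;> simp [Set.MapsTo, Set.LeftInvOn, Set.RightInvOn]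

theorem sum_weight_card_stabilizer {β : Type*} [Fintype β] [DecidableEq β] (P : (β → ℕ) → Prop)
    [DecidablePred P] :
    ∑ f : α → β with P (fiberSize f), #{g : Perm α | ∀ x, f (g x) = f x}
      = (Fintype.card α).factorial * #{N ∈ piAntidiag univ (Fintype.card α) | P N} := by
  rw [← Finset.sum_fiberwise_of_maps_to (g := fiberSize)
    (t := {N ∈ piAntidiag univ (Fintype.card α) | P N})]
  · rw [Finset.card_eq_sum_ones, Finset.mul_sum]
    refine Finset.sum_congr rfl fun N hN => ?_
    simp only [mem_filter, mem_piAntidiag] at hN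
    rw [mul_one, ← sum_card_stabilizer N hN.1.1, Finset.filter_filter]
    refine Finset.sum_congr (Finset.filter_congr fun f _ => ?_) fun _ _ => rfl
    exact ⟨fun h => h.2, fun h => ⟨h ▸ hN.2, h⟩⟩
  · intro f hf
    simp only [mem_filter, mem_piAntidiag, mem_univ, true_and] at hf ⊢
    exact ⟨⟨sum_fiberSize f, by simp⟩, hf⟩

/-- The part `0` of either decomposition meets the nonzero parts of the other one in at most one
element. -/
def IsThin (N : Fin 3 × Fin 3 → ℕ) : Prop :=
  ∀ j, j ≠ 0 → N (0, j) ≤ 1 ∧ N (j, 0) ≤ 1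

instance : DecidablePred IsThin := fun N => by unfold IsThin; infer_instance

/-- Off the common block of the two parts 0, each of these parts meets the other blocks in at most
one point, which `g` fixes. Both signs are thus the sign of `g` on the common block. -/
theorem sgnOn_eq_of_thin {d d' : α → Fin 3} (hthin : IsThin (fiberSize fun x => (d x, d' x)))
    {g : Perm α} (hg : ∀ x, d (g x) = d x) (hg' : ∀ x, d' (g x) = d' x) :
    sgnOn 0 d g * sgnOn 0 d' g = 1 := by
  have hc : ∀ i j, fiberSize (fun x => (d x, d' x)) (i, j) ≤ 1 →
      ∀ x, d x = i → d' x = j → g x = x := by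
    intro i j h x hx hx'
    refine Finset.card_le_one.1 h _ ?_ _ ?_ <;> simp [hg, hg', hx, hx']
  have hp : ∀ x, (d (g x) = 0 ∧ d' (g x) = 0) ↔ (d x = 0 ∧ d' x = 0) := fun x => by
    rw [hg, hg']
  set h : Perm α := ofSubtype (g.subtypePerm (p := fun x => d x = 0 ∧ d' x = 0) hp) with hh
  have h1 : ∀ x, d x = 0 ∧ d' x = 0 → h x = g x := fun x hx => by
    rw [hh, ofSubtype_subtypePerm_of_mem (p := fun x => d x = 0 ∧ d' x = 0) _ hx]
  have h2 : ∀ x, ¬ (d x = 0 ∧ d' x = 0) → h x = x := fun x hx => by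
    rw [hh, ofSubtype_subtypePerm_of_not_mem (p := fun x => d x = 0 ∧ d' x = 0) _ hx]
  have hd : ∀ x, d (h x) = d x := fun x => by
    by_cases hx : d x = 0 ∧ d' x = 0
    · rw [h1 x hx, hg]
    · rw [h2 x hx]
  have hd' : ∀ x, d' (h x) = d' x := fun x => by
    by_cases hx : d x = 0 ∧ d' x = 0
    · rw [h1 x hx, hg']
    · rw [h2 x hx]
  have hfix : ∀ x, h x = g x → (h⁻¹ * g) x = x := fun x hx => by
    rw [mul_apply, ← hx]
    simp
  have e : g = h * (h⁻¹ * g) := by group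
  have s1 : sgnOn 0 d g = sign h := by
    rw [e, sgnOn_mul hd, sgnOn_eq_sign hd, sgnOn_eq_one, mul_one]
    · intro x
      have := hd (h⁻¹ (g x))
      simp only [← mul_apply, mul_inv_cancel_left] at this
      rw [← this, hg]
    · intro x hx
      refine hfix x ?_
      by_cases hx' : d' x = 0
      · exact h1 x ⟨hx, hx'⟩
      · rw [h2 x (by tauto), hc 0 _ (hthin _ hx').1 x hx rfl]
    · intro x hx
      by_contra hx'
      exact hx (h2 x (by tauto))
  have s2 : sgnOn 0 d' g = sign h := by
    rw [e, sgnOn_mul hd', sgnOn_eq_sign hd', sgnOn_eq_one, mul_one]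
    · intro x
      have := hd' (h⁻¹ (g x))
      simp only [← mul_apply, mul_inv_cancel_left] at this
      rw [← this, hg']
    · intro x hx
      refine hfix x ?_
      by_cases hx' : d x = 0
      · exact h1 x ⟨hx', hx⟩
      · rw [h2 x (by tauto), hc _ 0 (hthin _ hx').2 x rfl hx]
    · intro x hx
      by_contra hx'
      exact hx (h2 x (by tauto))
  rw [s1, s2, ← Units.val_mul, Int.units_mul_self, Units.val_one]

/-- If the pair is not thin, some swap preserves both decompositions and has sign -1 on exactly one
of the parts 0; translating by it shows that the sum equals its own negative. -/
theorem sum_sgnOn_mul_sgnOn (d d' : α → Fin 3) :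
    ∑ g, sgnOn 0 d g * sgnOn 0 d' g
      = if IsThin (fiberSize fun x => (d x, d' x)) then
          (#{g : Perm α | ∀ x, (d (g x), d' (g x)) = (d x, d' x)} : ℤ) else 0 := by
  split_ifs with h
  · rw [Finset.card_filter, Nat.cast_sum]
    refine Finset.sum_congr rfl fun g _ => ?_
    by_cases hg : ∀ x, (d (g x), d' (g x)) = (d x, d' x)
    · simp only [Prod.mk.injEq] at hg
      rw [if_pos (by simpa using hg), sgnOn_eq_of_thin h (fun x => (hg x).1) fun x => (hg x).2]
      rfl
    · rw [if_neg hg]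
      by_cases hd : ∀ x, d (g x) = d x
      · rw [sgnOn_of_not_stable (d := d'), mul_zero, Nat.cast_zero]
        exact fun hd' => hg fun x => by rw [hd, hd']
      · rw [sgnOn_of_not_stable hd, zero_mul, Nat.cast_zero]
  · obtain ⟨u, v, huv, hd, hd', h0⟩ : ∃ u v, u ≠ v ∧ d u = d v ∧ d' u = d' v ∧
        ((d u = 0 ∧ d' u ≠ 0) ∨ (d u ≠ 0 ∧ d' u = 0)) := by
      simp only [IsThin, not_forall, not_and_or, not_le] at h
      obtain ⟨j, hj, h | h⟩ := h <;> obtain ⟨u, hu, v, hv, huv⟩ := Finset.one_lt_card.1 h <;>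
        simp only [mem_filter, mem_univ, true_and, Prod.mk.injEq] at hu hv
      · exact ⟨u, v, huv, hu.1.trans hv.1.symm, hu.2.trans hv.2.symm, Or.inl ⟨hu.1, hu.2 ▸ hj⟩⟩
      · exact ⟨u, v, huv, hu.1.trans hv.1.symm, hu.2.trans hv.2.symm, Or.inr ⟨hu.1 ▸ hj, hu.2⟩⟩
    have key : ∑ g, sgnOn 0 d g * sgnOn 0 d' g = - ∑ g, sgnOn 0 d g * sgnOn 0 d' g := by
      conv_lhs => rw [← Equiv.sum_comp (Equiv.mulRight (swap u v))]
      rw [← Finset.sum_neg_distrib]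
      refine Finset.sum_congr rfl fun g _ => ?_
      rw [Equiv.coe_mulRight, sgnOn_mul_right (stable_swap hd), sgnOn_mul_right (stable_swap hd')]
      rcases h0 with ⟨h0, h0'⟩ | ⟨h0, h0'⟩
      · rw [sgnOn_swap_of_eq huv hd h0, sgnOn_swap_of_ne hd' h0']
        ring
      · rw [sgnOn_swap_of_ne hd h0, sgnOn_swap_of_eq huv hd' h0']
        ring
    omega

/-- The size vectors of pairs of decompositions with given part sizes that contribute to the inner
product of two signed counts. -/
def thinMatrices (n p q r s t u : ℕ) : Finset (Fin 3 × Fin 3 → ℕ) :=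
  {N ∈ piAntidiag univ n | IsThin N ∧ (∑ j, N (0, j) = p ∧ ∑ j, N (1, j) = q ∧ ∑ j, N (2, j) = r)
    ∧ (∑ i, N (i, 0) = s ∧ ∑ i, N (i, 1) = t ∧ ∑ i, N (i, 2) = u)}

theorem fiberSize_fst (d d' : α → Fin 3) (i : Fin 3) :
    ∑ j, fiberSize (fun x => (d x, d' x)) (i, j) = fiberSize d i := by
  unfold fiberSize
  rw [Finset.card_eq_sum_card_fiberwise (f := d') (t := univ) (by simp)]
  refine Finset.sum_congr rfl fun j _ => ?_
  rw [Finset.filter_filter]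
  simp

theorem fiberSize_snd (d d' : α → Fin 3) (j : Fin 3) :
    ∑ i, fiberSize (fun x => (d x, d' x)) (i, j) = fiberSize d' j := by
  unfold fiberSize
  rw [Finset.card_eq_sum_card_fiberwise (f := d) (t := univ) (by simp)]
  refine Finset.sum_congr rfl fun i _ => ?_
  rw [Finset.filter_filter]
  simp [and_comm]

theorem sum_signedCount_mul (p q r s t u : ℕ) :
    ∑ g : Perm α, signedCount g p q r * signedCount g s t u
      = (-1) ^ (p + s) * ((Fintype.card α).factorial
          * #(thinMatrices (Fintype.card α) p q r s t u)) := by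
  unfold signedCount
  simp_rw [← Finset.mul_sum, mul_mul_mul_comm, ← pow_add]
  rw [← Finset.mul_sum]
  congr 1
  simp_rw [Finset.sum_mul_sum]
  rw [Finset.sum_comm]
  simp_rw [Finset.sum_comm (s := (univ : Finset (Perm α)))]
  simp_rw [sum_sgnOn_mul_sgnOn]
  rw [← Finset.sum_product', ← Finset.sum_filter]
  have := sum_weight_card_stabilizer (α := α) (β := Fin 3 × Fin 3) (fun N => IsThin N ∧
    (∑ j, N (0, j) = p ∧ ∑ j, N (1, j) = q ∧ ∑ j, N (2, j) = r)
    ∧ (∑ i, N (i, 0) = s ∧ ∑ i, N (i, 1) = t ∧ ∑ i, N (i, 2) = u))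
  unfold thinMatrices
  rw [← Nat.cast_mul, ← this, Nat.cast_sum]
  refine Finset.sum_nbij' (fun x y => (x.1 y, x.2 y)) (fun f => (fun y => (f y).1, fun y => (f y).2))
    ?_ ?_ (by simp) (by simp) (by simp)
  · rintro ⟨d, d'⟩ h
    simp only [mem_filter, mem_product, mem_univ, true_and] at h ⊢
    simp only [fiberSize_fst, fiberSize_snd]
    tauto
  · intro f h
    simp only [mem_filter, mem_product, mem_univ, true_and] at h ⊢
    rw [← fiberSize_fst (fun y => (f y).1) (fun y => (f y).2),
      ← fiberSize_fst (fun y => (f y).1) (fun y => (f y).2),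
      ← fiberSize_fst (fun y => (f y).1) (fun y => (f y).2),
      ← fiberSize_snd (fun y => (f y).1) (fun y => (f y).2),
      ← fiberSize_snd (fun y => (f y).1) (fun y => (f y).2),
      ← fiberSize_snd (fun y => (f y).1) (fun y => (f y).2)]
    tauto

/-- Column 0 has sum at most p + 1 + 1. -/
theorem thinMatrices_eq_empty {n p q r s t u : ℕ} (h : p + 2 < s) :
    thinMatrices n p q r s t u = ∅ := by
  unfold thinMatrices
  rw [Finset.filter_eq_empty_iff]
  rintro N - ⟨h1, ⟨h2, -⟩, ⟨h3, -⟩⟩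
  have a1 := (h1 1 (by decide)).2
  have a2 := (h1 2 (by decide)).2
  rw [Fin.sum_univ_three] at h2 h3
  omega

/-- In the extreme case s = p + 2 all bounds are attained: column 0 is (p, 1, 1) and row 0 is (p, 0,
0). The remaining 2 × 2 block has prescribed margins, so its entry x = N(1, 1) determines it. -/
theorem card_thinMatrices {n p q r t u : ℕ} (h : p + q + r = n) (h' : p + 2 + t + u = n) :
    #(thinMatrices n p q r (p + 2) t u) = #{x ∈ range q | x ≤ t ∧ t + 1 ≤ r + x} := by
  unfold thinMatrices
  refine Finset.card_nbij' (fun N => N (1, 1))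
    (fun x ij => !![p, 0, 0; 1, x, q - 1 - x; 1, t - x, r - 1 - (t - x)] ij.1 ij.2) ?_ ?_ ?_ ?_
  · intro N hN
    simp only [coe_filter, mem_piAntidiag, Set.mem_ofPred_eq, Fin.sum_univ_three, IsThin,
      mem_range] at hN ⊢
    obtain ⟨-, h1, h2, h3⟩ := hN
    have a1 := h1 1 (by decide)
    have a2 := h1 2 (by decide)
    omega
  · intro x hx
    simp only [coe_filter, mem_piAntidiag, Set.mem_ofPred_eq, Fin.sum_univ_three, IsThin,
      mem_range, Fintype.sum_prod_type] at hx ⊢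
    simp only [Matrix.of_apply, Matrix.cons_val, ne_eq, mem_univ, implies_true, and_true]
    obtain ⟨q', rfl⟩ := Nat.exists_eq_add_of_lt hx.1
    obtain ⟨t', rfl⟩ := Nat.exists_eq_add_of_le hx.2.1
    obtain ⟨r', rfl⟩ : ∃ r', r = t' + 1 + r' := Nat.exists_eq_add_of_le (by omega)
    have e1 : x + q' + 1 - 1 - x = q' := by omega
    have e2 : x + t' - x = t' := by omega
    have e3 : t' + 1 + r' - 1 - t' = r' := by omega
    rw [e1, e2, e3]
    clear e1 e2 e3
    refine ⟨by omega, ?_, ⟨rfl, by ring, by ring⟩, trivial, by ring, ?_⟩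
    rotate_left
    · have hu : 0 + q' + r' = u := by omega
      exact hu
    intro j hj
    fin_cases j <;> simp at hj ⊢
  · intro N hN
    simp only [coe_filter, mem_piAntidiag, Set.mem_ofPred_eq, Fin.sum_univ_three, IsThin] at hN
    obtain ⟨-, h1, h2, h3⟩ := hN
    have a1 := h1 1 (by decide)
    have a2 := h1 2 (by decide)
    funext ⟨i, j⟩
    fin_cases i <;> fin_cases j <;>
      simp only [Matrix.of_apply, Matrix.cons_val, Fin.mk_one, Fin.zero_eta, Fin.reduceFinMk] <;>
      omega
  · intro x _
    rfl

/-- The terms i = v + 1 cancel by symmetry, leaving only sign parts of size at most v. -/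
theorem twoRowsFun_eq (g : Perm α) (a c v : ℕ) :
    twoRowsFun g a c v = (-1) ^ (v + 1) * ∑ i ∈ range (v + 1),
      (signedCount g i (a + v + 1 - i) c - signedCount g i (c + v + 1 - i) a) := by
  unfold twoRowsFun
  rw [Finset.sum_range_succ _ (v + 1), signedCount_symm g (v + 1) (a + v + 1 - (v + 1)),
    show a + v + 1 - (v + 1) = a by omega, show c + v + 1 - (v + 1) = c by omega, sub_self,
    add_zero]

/-- The complementary form, with sign parts of size at least v + 2 only, obtained by subtracting the
vanishing full sums. -/
theorem twoRowsFun_eq_dual (g : Perm α) {a c v : ℕ} (h : a + c + v + 1 = Fintype.card α) :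
    twoRowsFun g a c v = - (-1) ^ (v + 1) *
      (∑ i ∈ range a, signedCount g (v + 2 + i) (a - 1 - i) c
        - ∑ i ∈ range c, signedCount g (v + 2 + i) (c - 1 - i) a) := by
  have h1 := sum_signedCount_eq g (N := a + v + 1) (r := c) (by omega)
  have h2 := sum_signedCount_eq g (N := c + v + 1) (r := a) (by omega)
  rw [if_neg (by omega), show a + v + 1 + 1 = v + 2 + a by ring, Finset.sum_range_add] at h1
  rw [if_neg (by omega), show c + v + 1 + 1 = v + 2 + c by ring, Finset.sum_range_add] at h2
  have e1 : ∀ i, a + v + 1 - (v + 2 + i) = a - 1 - i := fun i => by omega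
  have e2 : ∀ i, c + v + 1 - (v + 2 + i) = c - 1 - i := fun i => by omega
  simp_rw [e1] at h1
  simp_rw [e2] at h2
  unfold twoRowsFun
  rw [Finset.sum_sub_distrib]
  linear_combination (-1) ^ (v + 1) * (h1 - h2)

theorem sum_signedCount_mul_eq {v q r t u : ℕ} (h : v + q + r = Fintype.card α)
    (h' : v + 2 + t + u = Fintype.card α) :
    ∑ g : Perm α, signedCount g v q r * signedCount g (v + 2) t u
      = (Fintype.card α).factorial * #{x ∈ range q | x ≤ t ∧ t + 1 ≤ r + x} := by
  rw [sum_signedCount_mul, card_thinMatrices h h', ← add_assoc, pow_add, ← two_mul, pow_mul]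
  simp

theorem sum_sum_signedCount_mul (v m : ℕ) (q r t : ℕ → ℕ) (u : ℕ) :
    ∑ g : Perm α, (∑ i ∈ range (v + 1), signedCount g i (q i) (r i))
        * ∑ j ∈ range m, signedCount g (v + 2 + j) (t j) u
      = if m = 0 then 0 else
        ∑ g : Perm α, signedCount g v (q v) (r v) * signedCount g (v + 2) (t 0) u := by
  rcases m with _ | m
  · simp
  rw [if_neg (by omega)]
  simp_rw [Finset.sum_mul_sum]
  rw [Finset.sum_comm, Finset.sum_range_succ, Finset.sum_eq_zero, zero_add, Finset.sum_comm,
    Finset.sum_range_succ', Finset.sum_eq_zero, zero_add]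
  · intro j _
    rw [sum_signedCount_mul, thinMatrices_eq_empty (by omega)]
    simp
  · intro i hi
    rw [mem_range] at hi
    rw [Finset.sum_comm]
    refine Finset.sum_eq_zero fun j _ => ?_
    rw [sum_signedCount_mul, thinMatrices_eq_empty (by omega)]
    simp

/-- One factor is written with sign parts ≤ v, the other with sign parts ≥ v + 2. Thinness lets only
the pair (v, v + 2) survive, and the four matrix counts combine to -c + c + (c + 1) - c = 1. -/
theorem sum_twoRowsFun_sq {a c v : ℕ} (h : a + c + v + 1 = Fintype.card α) (hac : c < a) :
    ∑ g : Perm α, twoRowsFun g a c v ^ 2 = (Fintype.card α).factorial := by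
  have e : ∀ g : Perm α, twoRowsFun g a c v ^ 2 =
      -((∑ i ∈ range (v + 1), signedCount g i (a + v + 1 - i) c)
          * ∑ j ∈ range a, signedCount g (v + 2 + j) (a - 1 - j) c)
      + (∑ i ∈ range (v + 1), signedCount g i (a + v + 1 - i) c)
          * ∑ j ∈ range c, signedCount g (v + 2 + j) (c - 1 - j) a
      + (∑ i ∈ range (v + 1), signedCount g i (c + v + 1 - i) a)
          * ∑ j ∈ range a, signedCount g (v + 2 + j) (a - 1 - j) c
      - (∑ i ∈ range (v + 1), signedCount g i (c + v + 1 - i) a)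
          * ∑ j ∈ range c, signedCount g (v + 2 + j) (c - 1 - j) a := by
    intro g
    have hs : ((-1 : ℤ) ^ (v + 1)) ^ 2 = 1 := by rw [← pow_mul, mul_comm, pow_mul]; simp
    rw [sq]
    nth_rewrite 1 [twoRowsFun_eq]
    rw [twoRowsFun_eq_dual g h, Finset.sum_sub_distrib]
    linear_combination (-((∑ i ∈ range (v + 1), signedCount g i (a + v + 1 - i) c)
      - ∑ i ∈ range (v + 1), signedCount g i (c + v + 1 - i) a)
      * (∑ j ∈ range a, signedCount g (v + 2 + j) (a - 1 - j) c
        - ∑ j ∈ range c, signedCount g (v + 2 + j) (c - 1 - j) a)) * hs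
  simp_rw [e]
  rw [Finset.sum_sub_distrib, Finset.sum_add_distrib, Finset.sum_add_distrib,
    Finset.sum_neg_distrib]
  simp only [sum_sum_signedCount_mul]
  rw [if_neg (show ¬ a = 0 by omega), if_neg (show ¬ a = 0 by omega), show a + v + 1 - v = a + 1 by omega,
    show c + v + 1 - v = c + 1 by omega,
    sum_signedCount_mul_eq (q := a + 1) (t := a - 1 - 0) (by omega) (by omega),
    sum_signedCount_mul_eq (q := c + 1) (t := a - 1 - 0) (by omega) (by omega)]
  have k1 : #{x ∈ range (a + 1) | x ≤ a - 1 - 0 ∧ a - 1 - 0 + 1 ≤ c + x} = c := by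
    rw [show ({x ∈ range (a + 1) | x ≤ a - 1 - 0 ∧ a - 1 - 0 + 1 ≤ c + x}) = Ico (a - c) a by
      ext x; simp only [mem_filter, mem_range, mem_Ico]; omega, Nat.card_Ico]
    omega
  have k2 : #{x ∈ range (c + 1) | x ≤ a - 1 - 0 ∧ a - 1 - 0 + 1 ≤ a + x} = c + 1 := by
    rw [Finset.filter_true_of_mem fun x hx => by rw [mem_range] at hx; omega, card_range]
  rw [k1, k2]
  split_ifs with hc
  · subst hc
    push_cast
    ring
  have k3 : #{x ∈ range (a + 1) | x ≤ c - 1 - 0 ∧ c - 1 - 0 + 1 ≤ c + x} = c := by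
    rw [show ({x ∈ range (a + 1) | x ≤ c - 1 - 0 ∧ c - 1 - 0 + 1 ≤ c + x}) = range c by
      ext x; simp only [mem_filter, mem_range]; omega, card_range]
  have k4 : #{x ∈ range (c + 1) | x ≤ c - 1 - 0 ∧ c - 1 - 0 + 1 ≤ a + x} = c := by
    rw [show ({x ∈ range (c + 1) | x ≤ c - 1 - 0 ∧ c - 1 - 0 + 1 ≤ a + x}) = range c by
      ext x; simp only [mem_filter, mem_range]; omega, card_range]
  rw [sum_signedCount_mul_eq (by omega) (by omega), sum_signedCount_mul_eq (by omega) (by omega),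
    k3, k4]
  push_cast
  ring

end Orthogonality

/-! ### Traces on the left ideal generated by a quasi-idempotent of a group algebra. -/

section CyclicModuleTrace

open Finset MonoidAlgebra

variable {G : Type*} [Group G] [Fintype G] [DecidableEq G]

instance : Module.Finite ℂ (MonoidAlgebra ℂ G) := Module.Finite.of_basis (MonoidAlgebra.basis G ℂ)

theorem MonoidAlgebra.eq_sum_single (x : MonoidAlgebra ℂ G) :
    x = ∑ g, x.coeff g • single g (1 : ℂ) := by
  ext h
  rw [coeff_sum]
  simp

instance (I : Ideal (MonoidAlgebra ℂ G)) : Module.Finite ℂ I :=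
  Module.Finite.of_injective (I.subtype.restrictScalars ℂ) Subtype.val_injective

theorem trace_of_idempotent {V : Type*} [AddCommGroup V] [Module ℂ V] [Module.Finite ℂ V]
    {E : V →ₗ[ℂ] V} (hE : E * E = E) :
    LinearMap.trace ℂ V E = Module.finrank ℂ (LinearMap.range E) :=
  (LinearMap.IsIdempotentElem.isProj_range E hE).trace

theorem finrank_range_pos {V : Type*} [AddCommGroup V] [Module ℂ V] [Module.Finite ℂ V]
    {E : V →ₗ[ℂ] V} (hE : E ≠ 0) : 1 ≤ Module.finrank ℂ (LinearMap.range E) := by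
  rw [Nat.one_le_iff_ne_zero]
  intro h
  exact hE (LinearMap.range_eq_bot.1 (Submodule.finrank_eq_zero.1 h))

/-- The trace of an element of the group algebra on the left ideal generated by `c`. -/
noncomputable def idealTrace (c : MonoidAlgebra ℂ G) : MonoidAlgebra ℂ G →ₗ[ℂ] ℂ :=
  LinearMap.trace ℂ (Ideal.span {c} : Ideal (MonoidAlgebra ℂ G)) ∘ₗ
    (Algebra.lsmul ℂ ℂ (Ideal.span {c} : Ideal (MonoidAlgebra ℂ G))).toLinearMap

theorem idealTrace_apply (c x : MonoidAlgebra ℂ G) :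
    idealTrace c x = LinearMap.trace ℂ (Ideal.span {c} : Ideal (MonoidAlgebra ℂ G))
      (Algebra.lsmul ℂ ℂ (Ideal.span {c} : Ideal (MonoidAlgebra ℂ G)) x) := rfl

theorem trace_ofModule' (c : MonoidAlgebra ℂ G) (g : G) :
    LinearMap.trace ℂ (Ideal.span {c} : Ideal (MonoidAlgebra ℂ G))
      (Representation.ofModule' (k := ℂ) (G := G) (Ideal.span {c} : Ideal (MonoidAlgebra ℂ G)) g)
      = idealTrace c (single g 1) := rfl

theorem idealTrace_mul_comm (c x y : MonoidAlgebra ℂ G) :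
    idealTrace c (x * y) = idealTrace c (y * x) := by
  rw [idealTrace_apply, idealTrace_apply, map_mul (Algebra.lsmul ℂ ℂ _),
    map_mul (Algebra.lsmul ℂ ℂ _), LinearMap.trace_mul_comm]

theorem idealTrace_conj (c : MonoidAlgebra ℂ G) (g h : G) :
    idealTrace c (single (h * g * h⁻¹) 1) = idealTrace c (single g 1) := by
  have : (single (h * g * h⁻¹) 1 : MonoidAlgebra ℂ G) = single (h * g) 1 * single h⁻¹ 1 := by
    rw [single_mul_single, one_mul]
  rw [this, idealTrace_mul_comm, single_mul_single]
  simp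

theorem idealTrace_eq_sum (c x : MonoidAlgebra ℂ G) :
    idealTrace c x = ∑ g, x.coeff g * idealTrace c (single g 1) := by
  conv_lhs => rw [x.eq_sum_single]
  rw [map_sum]
  exact Finset.sum_congr rfl fun g _ => by rw [map_smul, smul_eq_mul]

theorem idealTrace_eq_zero {c e : MonoidAlgebra ℂ G} (h : ∀ g, e * single g 1 * c = 0) :
    idealTrace c e = 0 := by
  have h' : ∀ x, e * x * c = 0 := fun x => by
    rw [x.eq_sum_single, Finset.mul_sum, Finset.sum_mul]
    exact Finset.sum_eq_zero fun g _ => by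
      rw [mul_smul_comm, smul_mul_assoc, h, smul_zero]
  have : Algebra.lsmul ℂ ℂ (Ideal.span {c} : Ideal (MonoidAlgebra ℂ G)) e = 0 := by
    ext ⟨v, hv⟩
    obtain ⟨x, rfl⟩ := Ideal.mem_span_singleton'.1 hv
    simp [← mul_assoc, h']
  rw [idealTrace_apply, this, map_zero]

/-- After division by `μ`, `e` acts as a projection, whose trace is its rank; the rank is positive
because `e` does not annihilate the ideal. -/
theorem exists_idealTrace_eq {c e : MonoidAlgebra ℂ G} {μ : ℂ} (hμ : μ ≠ 0) (he : e * e = μ • e)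
    (h : ∃ x, e * x * c ≠ 0) : ∃ r : ℕ, 1 ≤ r ∧ idealTrace c e = μ * r := by
  set V := (Ideal.span {c} : Ideal (MonoidAlgebra ℂ G))
  set E : V →ₗ[ℂ] V := μ⁻¹ • Algebra.lsmul ℂ ℂ V e
  have hE : E * E = E := by
    unfold E
    rw [smul_mul_smul_comm, ← map_mul, he, map_smul, smul_smul, mul_assoc, inv_mul_cancel₀ hμ,
      mul_one]
  have htr : idealTrace c e = μ * LinearMap.trace ℂ V E := by
    unfold E
    rw [map_smul, smul_eq_mul, mul_inv_cancel_left₀ hμ]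
    rfl
  refine ⟨Module.finrank ℂ (LinearMap.range E), ?_, ?_⟩
  · refine finrank_range_pos fun h1 => ?_
    obtain ⟨x, hx⟩ := h
    have h2 := congrArg Subtype.val
      (LinearMap.congr_fun h1 ⟨x * c, Ideal.mem_span_singleton'.2 ⟨x, rfl⟩⟩)
    simp only [E, LinearMap.smul_apply, Algebra.lsmul_coe, LinearMap.zero_apply] at h2
    have h3 : μ⁻¹ • (e * (x * c)) = 0 := h2
    rw [smul_eq_zero, ← mul_assoc] at h3
    exact h3.elim (inv_ne_zero hμ) hx
  · rw [htr, trace_of_idempotent hE]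

theorem trace_mulLeft_mulRight (x c : MonoidAlgebra ℂ G) :
    LinearMap.trace ℂ _ (LinearMap.mulLeft ℂ x ∘ₗ LinearMap.mulRight ℂ c)
      = ∑ h, (x * (single h 1 * c)).coeff h := by
  rw [LinearMap.trace_eq_matrix_trace ℂ (MonoidAlgebra.basis G ℂ), Matrix.trace]
  refine Finset.sum_congr rfl fun h _ => ?_
  rw [Matrix.diag_apply, LinearMap.toMatrix_apply]
  rfl

/-- Right multiplication by `c` maps the algebra onto the ideal, and is `κ` on the ideal; cyclicity
of the trace moves the computation to the whole algebra, where a basis is at hand. -/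
theorem idealTrace_eq_trace {c : MonoidAlgebra ℂ G} {κ : ℂ} (hκ : κ ≠ 0) (hc : c * c = κ • c)
    (x : MonoidAlgebra ℂ G) :
    idealTrace c x = κ⁻¹ * ∑ h, (x * (single h 1 * c)).coeff h := by
  set V := (Ideal.span {c} : Ideal (MonoidAlgebra ℂ G))
  set p : MonoidAlgebra ℂ G →ₗ[ℂ] V :=
    { toFun := fun y => ⟨y * c, Ideal.mem_span_singleton'.2 ⟨y, rfl⟩⟩
      map_add' := fun y z => Subtype.ext (add_mul y z c)
      map_smul' := fun t y => Subtype.ext (smul_mul_assoc t y c) }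
  set ι : V →ₗ[ℂ] MonoidAlgebra ℂ G :=
    { toFun := fun y => x * y.1
      map_add' := fun y z => mul_add x y.1 z.1
      map_smul' := fun t y => mul_smul_comm t x y.1 }
  have h1 : p ∘ₗ ι = κ • Algebra.lsmul ℂ ℂ V x := by
    ext ⟨v, hv⟩ : 2
    obtain ⟨y, rfl⟩ := Ideal.mem_span_singleton'.1 hv
    change x * (y * c) * c = κ • (x * (y * c))
    rw [mul_assoc, mul_assoc y, hc, mul_smul_comm, mul_smul_comm]
  have h2 : ι ∘ₗ p = LinearMap.mulLeft ℂ x ∘ₗ LinearMap.mulRight ℂ c := rfl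
  have h3 := LinearMap.trace_comp_comm' p ι
  rw [h1, h2, trace_mulLeft_mulRight, map_smul, smul_eq_mul] at h3
  rw [h3, inv_mul_cancel_left₀ hκ]
  rfl

theorem idealTrace_single {c : MonoidAlgebra ℂ G} {κ : ℂ} (hκ : κ ≠ 0) (hc : c * c = κ • c)
    (g : G) : idealTrace c (single g 1) = κ⁻¹ * ∑ h, c.coeff (h⁻¹ * g⁻¹ * h) := by
  rw [idealTrace_eq_trace hκ hc]
  simp [mul_assoc]

/-- If c² = 0, right multiplication by `c` is nilpotent and has trace 0, whereas its trace is the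
group order times the coefficient of `c` at 1. -/
theorem quasiIdempotent_ne_zero {c : MonoidAlgebra ℂ G} {κ : ℂ} (hc : c * c = κ • c)
    (h1 : c.coeff 1 = 1) : κ ≠ 0 := by
  rintro rfl
  rw [zero_smul] at hc
  have h2 := trace_mulLeft_mulRight 1 c
  have h3 : IsNilpotent (LinearMap.mulLeft ℂ 1 ∘ₗ LinearMap.mulRight ℂ c :
      MonoidAlgebra ℂ G →ₗ[ℂ] MonoidAlgebra ℂ G) := by
    refine ⟨2, ?_⟩
    refine LinearMap.ext fun y => ?_
    simp [sq, mul_assoc, hc]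
  have h4 := (LinearMap.isNilpotent_trace_of_isNilpotent h3).eq_zero
  rw [h2] at h4
  simp [h1] at h4

theorem quasiIdempotent_eq {c : MonoidAlgebra ℂ G} {κ : ℂ} (hc : c * c = κ • c)
    (h1 : c.coeff 1 = 1) : ∃ r : ℝ, κ = r := by
  have hκ := quasiIdempotent_ne_zero hc h1
  have h2 := idealTrace_eq_trace hκ hc 1
  rw [idealTrace_apply, map_one, LinearMap.trace_one] at h2
  simp only [coeff_single_mul_apply, one_mul, inv_mul_cancel, h1, Finset.sum_const, nsmul_eq_mul,
    mul_one] at h2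
  set m := Module.finrank ℂ (Ideal.span {c} : Ideal (MonoidAlgebra ℂ G))
  refine ⟨(#(univ : Finset G) : ℝ) / m, ?_⟩
  have hm : (m : ℂ) ≠ 0 := by
    rw [h2]
    refine mul_ne_zero (inv_ne_zero hκ) ?_
    simp
  push_cast
  rw [h2]
  field_simp

/-- By `idealTrace_single` the square sum reduces to |G| κ⁻¹ times the trace of `c` on its own
ideal. That trace is `κ`, since `c` acts there as `κ` times a projection onto the line spanned by
`c`. -/
theorem sum_idealTrace_sq {c : MonoidAlgebra ℂ G} (hG : ∀ g : G, IsConj g g⁻¹)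
    (hc : ∀ g, ∃ t : ℂ, c * single g 1 * c = t • c) {κ : ℂ} (hcc : c * c = κ • c)
    (h1 : c.coeff 1 = 1) : ∑ g, idealTrace c (single g 1) ^ 2 = Fintype.card G := by
  have hκ := quasiIdempotent_ne_zero hcc h1
  have hinv : ∀ g h : G, idealTrace c (single (h * g⁻¹ * h⁻¹) 1) = idealTrace c (single g 1) := by
    intro g h
    obtain ⟨k, hk⟩ := isConj_iff.1 (hG g)
    rw [idealTrace_conj, ← hk, idealTrace_conj]
  have hce : idealTrace c c = κ := by
    set V := (Ideal.span {c} : Ideal (MonoidAlgebra ℂ G))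
    set E : V →ₗ[ℂ] V := κ⁻¹ • Algebra.lsmul ℂ ℂ V c
    have hE : E * E = E := by
      unfold E
      rw [smul_mul_smul_comm, ← map_mul, hcc, map_smul, smul_smul, mul_assoc, inv_mul_cancel₀ hκ,
        mul_one]
    have htr : idealTrace c c = κ * LinearMap.trace ℂ V E := by
      unfold E
      rw [map_smul, smul_eq_mul, mul_inv_cancel_left₀ hκ]
      rfl
    have hmul : ∀ x, ∃ t : ℂ, c * x * c = t • c := by
      intro x
      choose t ht using hc
      refine ⟨∑ g, x.coeff g * t g, ?_⟩
      conv_lhs => rw [x.eq_sum_single]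
      rw [Finset.mul_sum, Finset.sum_mul, Finset.sum_smul]
      refine Finset.sum_congr rfl fun g _ => ?_
      rw [mul_smul_comm, smul_mul_assoc, ht, smul_smul]
    have hcV : c ∈ V := Ideal.mem_span_singleton_self c
    have hcE : (⟨c, hcV⟩ : V) ∈ LinearMap.range E := by
      refine ⟨⟨c, hcV⟩, Subtype.ext ?_⟩
      change κ⁻¹ • (c * c) = c
      rw [hcc, inv_smul_smul₀ hκ]
    have hfin : Module.finrank ℂ (LinearMap.range E) = 1 := by
      refine (finrank_eq_one_iff_of_nonzero' (⟨⟨c, hcV⟩, hcE⟩ : LinearMap.range E) ?_).2 ?_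
      · intro h0
        have h2 : c = 0 := congrArg (fun w => (w.1.1 : MonoidAlgebra ℂ G)) h0
        rw [h2] at h1
        simp at h1
      · rintro ⟨w, ⟨⟨v, hv⟩, rfl⟩⟩
        obtain ⟨x, rfl⟩ := Ideal.mem_span_singleton'.1 hv
        obtain ⟨t, ht⟩ := hmul x
        refine ⟨κ⁻¹ * t, Subtype.ext (Subtype.ext ?_)⟩
        change (κ⁻¹ * t) • c = κ⁻¹ • (c * (x * c))
        rw [← mul_assoc, ht, smul_smul]
    rw [htr, trace_of_idempotent hE, hfin]
    simp
  have h2 : ∑ g, idealTrace c (single g 1) ^ 2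
      = κ⁻¹ * ∑ h : G, ∑ g, c.coeff (h⁻¹ * g⁻¹ * h) * idealTrace c (single g 1) := by
    rw [Finset.sum_comm, Finset.mul_sum]
    refine Finset.sum_congr rfl fun g _ => ?_
    rw [sq]
    nth_rewrite 1 [idealTrace_single hκ hcc g]
    rw [mul_assoc, Finset.sum_mul]
  have h3 : ∀ h : G, ∑ g, c.coeff (h⁻¹ * g⁻¹ * h) * idealTrace c (single g 1) = κ := by
    intro h
    rw [← hce, idealTrace_eq_sum c c]
    refine Fintype.sum_bijective (fun g => h⁻¹ * g⁻¹ * h)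
      ((MulAut.conj h⁻¹).bijective.comp (Equiv.inv G).bijective |> fun hb => by
        simpa [Function.comp_def, MulAut.conj_apply] using hb) _ _ fun g => ?_
    have := hinv g h⁻¹
    rw [inv_inv] at this
    rw [this]
  rw [h2, Finset.sum_congr rfl fun h _ => h3 h, Finset.sum_const, nsmul_eq_mul, Finset.card_univ]
  field_simp

/-- With χ the trace, real-valued here, Σ (f - χ)² = 2|G| - 2r ≤ 0, so f = χ. A lower bound for the
inner sum is enough. -/
theorem idealTrace_eq_of_inner {c : MonoidAlgebra ℂ G} (hG : ∀ g : G, IsConj g g⁻¹)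
    (hc : ∀ g, ∃ t : ℂ, c * single g 1 * c = t • c) (h1 : c.coeff 1 = 1)
    (hreal : ∀ g, ∃ r : ℝ, c.coeff g = r) (f : G → ℝ) (hf : ∑ g, f g ^ 2 = Fintype.card G)
    (hfc : ∃ r : ℝ, Fintype.card G ≤ r ∧ ∑ g, (f g : ℂ) * idealTrace c (single g 1) = r) (g : G) :
    idealTrace c (single g 1) = f g := by
  obtain ⟨κ, hcc⟩ := hc 1
  rw [← MonoidAlgebra.one_def, mul_one] at hcc
  have hκ := quasiIdempotent_ne_zero hcc h1
  obtain ⟨κ', hκ'⟩ := quasiIdempotent_eq hcc h1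
  choose c' hc' using hreal
  set χ : G → ℝ := fun g => κ'⁻¹ * ∑ h, c' (h⁻¹ * g⁻¹ * h) with hχ
  have hχ' : ∀ g, idealTrace c (single g 1) = χ g := by
    intro g
    rw [idealTrace_single hκ hcc, hχ, hκ']
    push_cast
    simp_rw [hc']
  have h2 : ∑ g, χ g ^ 2 = Fintype.card G := by
    have := sum_idealTrace_sq hG hc hcc h1
    simp_rw [hχ'] at this
    exact_mod_cast this
  obtain ⟨r, hr, hr'⟩ := hfc
  have h3 : ∑ g, f g * χ g = r := by
    simp_rw [hχ'] at hr'
    exact_mod_cast hr'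
  have h4 : ∑ g, (f g - χ g) ^ 2 ≤ 0 := by
    have : ∑ g, (f g - χ g) ^ 2 = ∑ g, f g ^ 2 - 2 * ∑ g, f g * χ g + ∑ g, χ g ^ 2 := by
      rw [Finset.mul_sum, ← Finset.sum_sub_distrib, ← Finset.sum_add_distrib]
      exact Finset.sum_congr rfl fun g _ => by ring
    rw [this, hf, h2, h3]
    linarith
  have h5 := (Finset.sum_eq_zero_iff_of_nonneg fun g _ => sq_nonneg (f g - χ g)).1
    (le_antisymm h4 (Finset.sum_nonneg fun g _ => sq_nonneg _)) g (mem_univ g)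
  rw [hχ', sub_eq_zero.1 (pow_eq_zero_iff two_ne_zero |>.1 h5)]

end CyclicModuleTrace

/-! ### The Young symmetrizer of (a, c + 1, 1^v) and its character. -/

section YoungSymmetrizer

open Finset MonoidAlgebra Equiv Equiv.Perm

variable {α : Type*} [Fintype α] [DecidableEq α]

/-- The sum of the permutations that preserve the fibres of `row`. -/
noncomputable def rowSum (row : α → ℕ) : MonoidAlgebra ℂ (Perm α) :=
  ∑ g : Perm α with ∀ i, row (g i) = row i, single g 1

/-- The signed sum of the permutations that preserve the fibres of `col`. -/
noncomputable def colSum (col : α → ℕ) : MonoidAlgebra ℂ (Perm α) :=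
  ∑ g : Perm α with ∀ i, col (g i) = col i, single g ((sign g : ℤ) : ℂ)

/-- The sum of the permutations that preserve the decomposition `d`, weighted by their signs on
the part `0`. -/
noncomputable def decompSum (d : α → Fin 3) : MonoidAlgebra ℂ (Perm α) :=
  ∑ g : Perm α, single g (sgnOn 0 d g : ℂ)

theorem coeff_decompSum (d : α → Fin 3) (g : Perm α) :
    (decompSum d).coeff g = sgnOn 0 d g := by
  simp [decompSum, MonoidAlgebra.coeff_sum, Finsupp.single_apply]

theorem coeff_rowSum (row : α → ℕ) (g : Perm α) :
    (rowSum row).coeff g = if ∀ i, row (g i) = row i then 1 else 0 := by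
  simp [rowSum, MonoidAlgebra.coeff_sum, Finsupp.single_apply]

theorem coeff_colSum (col : α → ℕ) (g : Perm α) :
    (colSum col).coeff g = if ∀ i, col (g i) = col i then ((sign g : ℤ) : ℂ) else 0 := by
  simp [colSum, MonoidAlgebra.coeff_sum, Finsupp.single_apply]

theorem stable_mul_iff {ι : Type*} {d : α → ι} {g h : Perm α} (hh : ∀ x, d (h x) = d x) :
    (∀ x, d ((g * h) x) = d x) ↔ ∀ x, d (g x) = d x := by
  constructor
  · intro H x
    have h1 := H (h.symm x)
    have h2 := hh (h.symm x)
    simp only [mul_apply, apply_symm_apply] at h1 h2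
    rw [h1, h2]
  · intro H x
    rw [mul_apply, H, hh]

theorem stable_inv {ι : Type*} {d : α → ι} {h : Perm α} (hh : ∀ x, d (h x) = d x) (x : α) :
    d (h⁻¹ x) = d x := by
  have := hh (h.symm x)
  rw [apply_symm_apply] at this
  exact this.symm

theorem rowSum_mul_single {row : α → ℕ} {p : Perm α} (hp : ∀ i, row (p i) = row i) :
    rowSum row * single p 1 = rowSum row := by
  ext g
  rw [coeff_mul_single_apply, mul_one, coeff_rowSum, coeff_rowSum]
  exact if_congr (stable_mul_iff (stable_inv hp)) rfl rfl

theorem single_mul_colSum {col : α → ℕ} {q : Perm α} (hq : ∀ i, col (q i) = col i) :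
    single q 1 * colSum col = ((sign q : ℤ) : ℂ) • colSum col := by
  ext g
  rw [coeff_single_mul_apply, one_mul, coeff_smul_apply, coeff_colSum, coeff_colSum]
  have : (∀ i, col ((q⁻¹ * g) i) = col i) ↔ ∀ i, col (g i) = col i :=
    forall_congr' fun i => by rw [mul_apply, stable_inv hq]
  rw [if_congr this rfl rfl]
  split_ifs
  · rw [Perm.sign_mul, sign_inv]
    push_cast
    rfl
  · simp

theorem decompSum_mul_single {d : α → Fin 3} {y : Perm α} (hy : ∀ i, d (y i) = d i) :
    decompSum d * single y 1 = (sgnOn 0 d y : ℂ) • decompSum d := by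
  ext g
  rw [coeff_mul_single_apply, mul_one, coeff_smul_apply, coeff_decompSum, coeff_decompSum,
    sgnOn_mul_right (stable_inv hy)]
  have h1 : sgnOn 0 d y * sgnOn 0 d y⁻¹ = 1 := by
    rw [← sgnOn_mul hy, mul_inv_cancel, sgnOn_eq_one (by simp) (by simp)]
  have h2 := sgnOn_sq (z := 0) hy
  have h3 : sgnOn 0 d y⁻¹ = sgnOn 0 d y := by
    calc sgnOn 0 d y⁻¹ = (sgnOn 0 d y * sgnOn 0 d y) * sgnOn 0 d y⁻¹ := by rw [h2, one_mul]
      _ = sgnOn 0 d y := by rw [mul_assoc, h1, mul_one]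
  rw [h3]
  push_cast
  rw [smul_eq_mul, mul_comm]

theorem decompSum_mul_self (d : α → Fin 3) :
    decompSum d * decompSum d
      = ((#{g : Perm α | ∀ x, d (g x) = d x} : ℕ) : ℂ) • decompSum d := by
  have h : ∀ g : Perm α, decompSum d * single g (sgnOn 0 d g : ℂ)
      = (if ∀ x, d (g x) = d x then 1 else 0 : ℂ) • decompSum d := by
    intro g
    split_ifs with hg
    · have : (single g (sgnOn 0 d g : ℂ) : MonoidAlgebra ℂ (Perm α))
          = (sgnOn 0 d g : ℂ) • single g 1 := by simp
      rw [this, mul_smul_comm, decompSum_mul_single hg, smul_smul, ← Int.cast_mul, sgnOn_sq hg,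
        Int.cast_one]
    · rw [sgnOn_of_not_stable hg]
      simp
  nth_rewrite 2 [decompSum]
  rw [Finset.mul_sum, Finset.sum_congr rfl fun g _ => h g, ← Finset.sum_smul,
    Finset.sum_boole]

/-- The swap absorbed by `x` becomes, when moved past `g`, a swap within a column, and `colSum`
turns it into -1. -/
theorem mul_single_mul_colSum_eq_zero {x : MonoidAlgebra ℂ (Perm α)} {col : α → ℕ} {g : Perm α}
    {u v : α} (huv : u ≠ v) (hx : x * single (swap u v) 1 = x)
    (hcol : col (g⁻¹ u) = col (g⁻¹ v)) : x * single g 1 * colSum col = 0 := by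
  have h1 : swap u v * g = g * swap (g⁻¹ u) (g⁻¹ v) := by
    rw [mul_swap_eq_swap_mul]
    simp
  have h2 : x * single g 1 * colSum col = - (x * single g 1 * colSum col) := by
    conv_lhs => rw [← hx]
    have e1 : (single (swap u v) 1 * single g 1 : MonoidAlgebra ℂ (Perm α))
        = single g 1 * single (swap (g⁻¹ u) (g⁻¹ v)) 1 := by
      rw [single_mul_single, single_mul_single, h1]
    have hne : g⁻¹ u ≠ g⁻¹ v := fun h => huv (g⁻¹.injective h)
    rw [mul_assoc x, e1, mul_assoc, mul_assoc, single_mul_colSum (stable_swap hcol), sign_swap hne]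
    simp [mul_assoc]
  have h3 : (2 : ℂ) • (x * single g 1 * colSum col) = 0 := by
    rw [two_smul]
    nth_rewrite 2 [h2]
    exact add_neg_cancel _
  exact (smul_eq_zero.1 h3).resolve_left two_ne_zero

/-- `row` and `col` are the coordinates of a bijective filling of the boxes of the Young diagram
of `(a, c + 1, 1 ^ v)`. -/
structure IsTwoRowsFilling (row col : α → ℕ) (a c v : ℕ) : Prop where
  lt : c < a
  inj : ∀ i j, row i = row j → col i = col j → i = j
  cells : ∀ r s, (∃ i, row i = r ∧ col i = s) ↔
    (r = 0 ∧ s < a) ∨ (r = 1 ∧ s ≤ c) ∨ (2 ≤ r ∧ r < v + 2 ∧ s = 0)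

namespace IsTwoRowsFilling

variable {row col : α → ℕ} {a c v : ℕ} (h : IsTwoRowsFilling row col a c v)
include h

theorem cell (i : α) : (row i = 0 ∧ col i < a) ∨ (row i = 1 ∧ col i ≤ c)
    ∨ (2 ≤ row i ∧ row i < v + 2 ∧ col i = 0) := (h.cells _ _).1 ⟨i, rfl, rfl⟩

theorem col_lt (i : α) : col i < a := by
  have := h.cell i
  have := h.lt
  omega

theorem card_row_zero : #{i | row i = 0} = a := by
  rw [← card_range a]
  refine Finset.card_nbij col ?_ ?_ ?_
  · intro i _
    simpa using h.col_lt i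
  · intro i hi j hj hij
    simp only [coe_filter, mem_univ, true_and, Set.mem_ofPred_eq] at hi hj
    exact h.inj i j (hi.trans hj.symm) hij
  · intro s hs
    obtain ⟨i, hi⟩ := (h.cells 0 s).2 (by simp at hs; omega)
    exact ⟨i, by simpa using hi.1, hi.2⟩

theorem card_row_one : #{i | row i = 1} = c + 1 := by
  rw [← card_range (c + 1)]
  refine Finset.card_nbij col ?_ ?_ ?_
  · intro i hi
    have := h.cell i
    simp at hi ⊢
    omega
  · intro i hi j hj hij
    simp only [coe_filter, mem_univ, true_and, Set.mem_ofPred_eq] at hi hj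
    exact h.inj i j (hi.trans hj.symm) hij
  · intro s hs
    obtain ⟨i, hi⟩ := (h.cells 1 s).2 (by simp at hs; omega)
    exact ⟨i, by simpa using hi.1, hi.2⟩

theorem card_two_le_row : #{i | 2 ≤ row i} = v := by
  have : #(Ico 2 (v + 2)) = v := by simp
  rw [← this]
  refine Finset.card_nbij row ?_ ?_ ?_
  · intro i hi
    have := h.cell i
    simp at hi ⊢
    omega
  · intro i hi j hj hij
    have h1 := h.cell i
    have h2 := h.cell j
    simp only [coe_filter, mem_univ, true_and, Set.mem_ofPred_eq] at hi hj
    exact h.inj i j hij (by omega)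
  · intro r hr
    simp only [coe_Ico, Set.mem_Ico] at hr
    obtain ⟨i, hi⟩ := (h.cells r 0).2 (by omega)
    exact ⟨i, by simp only [coe_filter, mem_univ, true_and, Set.mem_ofPred_eq]; omega, hi.1⟩

theorem card_col_zero : #{i | col i = 0} = v + 2 := by
  rw [← card_range (v + 2)]
  refine Finset.card_nbij row ?_ ?_ ?_
  · intro i hi
    have := h.cell i
    simp at hi ⊢
    omega
  · intro i hi j hj hij
    simp only [coe_filter, mem_univ, true_and, Set.mem_ofPred_eq] at hi hj
    exact h.inj i j hij (hi.trans hj.symm)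
  · intro r hr
    simp only [coe_range, Set.mem_Iio] at hr
    have := h.lt
    obtain ⟨i, hi⟩ := (h.cells r 0).2 (by omega)
    exact ⟨i, by simpa using hi.2, hi.1⟩

/-- The combinatorial half of von Neumann's lemma for this shape: if no two entries of a row are
sent by `g⁻¹` into one column, every entry can be moved along its row into the column of its image.
-/
theorem exists_col_eq {g : Perm α}
    (hg : ∀ u w, row u = row w → col (g⁻¹ u) = col (g⁻¹ w) → u = w) (u : α) :
    ∃ i, row i = row u ∧ col i = col (g⁻¹ u) := by
  have hlt := h.lt
  have surj0 : ∀ s, s < a → ∃ w, row w = 0 ∧ col (g⁻¹ w) = s := by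
    intro s hs
    have := Finset.surj_on_of_inj_on_of_card_le (s := univ.filter fun i => row i = 0)
      (t := range a) (fun i _ => col (g⁻¹ i)) (fun i _ => by simpa using h.col_lt _)
      (fun i j hi hj hij => hg i j (by simp at hi hj; omega) hij)
      (by rw [h.card_row_zero, card_range]) s (by simpa using hs)
    obtain ⟨w, hw, rfl⟩ := this
    exact ⟨w, by simpa using hw, rfl⟩
  -- The image of the first row meets every column, and a column beyond `c` has only one box.
  have big : ∀ u, row u ≠ 0 → col (g⁻¹ u) ≤ c := by
    intro u hu
    by_contra hc
    obtain ⟨w, hw, hw'⟩ := surj0 (col (g⁻¹ u)) (h.col_lt _)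
    have c1 := h.cell (g⁻¹ u)
    have c2 := h.cell (g⁻¹ w)
    have := g⁻¹.injective (h.inj (g⁻¹ w) (g⁻¹ u) (by omega) hw')
    rw [this] at hw
    exact hu hw
  have surj1 : ∀ s, s ≤ c → ∃ w, row w = 1 ∧ col (g⁻¹ w) = s := by
    intro s hs
    have := Finset.surj_on_of_inj_on_of_card_le (s := univ.filter fun i => row i = 1)
      (t := range (c + 1)) (fun i _ => col (g⁻¹ i))
      (fun i hi => by
        simp only [mem_filter, mem_univ, true_and] at hi
        rw [mem_range]
        exact Nat.lt_succ_of_le (big i (by omega)))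
      (fun i j hi hj hij => hg i j (by simp at hi hj; omega) hij)
      (by rw [h.card_row_one, card_range]) s (by rw [mem_range]; omega)
    obtain ⟨w, hw, rfl⟩ := this
    exact ⟨w, by simpa using hw, rfl⟩
  refine (h.cells _ _).2 ?_
  have hcu := h.cell u
  by_cases h0 : row u = 0
  · exact Or.inl ⟨h0, h.col_lt _⟩
  have hb := big u h0
  by_cases h1 : row u = 1
  · exact Or.inr (Or.inl ⟨h1, hb⟩)
  refine Or.inr (Or.inr ⟨by omega, by omega, ?_⟩)
  -- A column s with 0 < s ≤ c has two boxes, but would contain the distinct images of `u`, `w0` and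
  -- `w1`.
  by_contra hs
  obtain ⟨w0, hw0, hw0'⟩ := surj0 (col (g⁻¹ u)) (h.col_lt _)
  obtain ⟨w1, hw1, hw1'⟩ := surj1 (col (g⁻¹ u)) hb
  have c0 := h.cell (g⁻¹ u)
  have c1 := h.cell (g⁻¹ w0)
  have c2 := h.cell (g⁻¹ w1)
  have key : ∀ x y, row x ≠ row y → col (g⁻¹ x) = col (g⁻¹ y) → row (g⁻¹ x) ≠ row (g⁻¹ y) :=
    fun x y hxy hc hr => hxy (congrArg row (g⁻¹.injective (h.inj _ _ hr hc)))
  have k1 := key u w0 (by omega) (by omega)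
  have k2 := key u w1 (by omega) (by omega)
  have k3 := key w0 w1 (by omega) (by omega)
  omega

/-- Either some swap annihilates the product, or g = p⁻¹ (p g) with `p` preserving rows and `p * g`
preserving columns. -/
theorem rowSum_mul_single_mul_colSum (g : Perm α) :
    ∃ t : ℂ, rowSum row * single g 1 * colSum col = t • (rowSum row * colSum col) := by
  by_cases hg : ∀ u w, row u = row w → col (g⁻¹ u) = col (g⁻¹ w) → u = w
  · choose f hf using h.exists_col_eq hg
    have hinj : Function.Injective f := fun u w huw =>
      hg u w (by rw [← (hf u).1, ← (hf w).1, huw]) (by rw [← (hf u).2, ← (hf w).2, huw])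
    set p : Perm α := Equiv.ofBijective f (Finite.injective_iff_bijective.1 hinj) with hp
    have hpr : ∀ i, row (p i) = row i := fun i => (hf i).1
    have hq : ∀ i, col ((p * g) i) = col i := fun i => by
      have := (hf (g i)).2
      rw [mul_apply]
      change col (f (g i)) = _
      rw [this]
      simp
    refine ⟨((sign (p * g) : ℤ) : ℂ), ?_⟩
    have e : (single g 1 : MonoidAlgebra ℂ (Perm α)) = single p⁻¹ 1 * single (p * g) 1 := by
      rw [single_mul_single, inv_mul_cancel_left, one_mul]
    rw [e, ← mul_assoc, rowSum_mul_single (stable_inv hpr), mul_assoc, single_mul_colSum hq,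
      mul_smul_comm]
  · push Not at hg
    obtain ⟨u, w, hr, hc, hne⟩ := hg
    exact ⟨0, by rw [zero_smul, mul_single_mul_colSum_eq_zero hne
      (rowSum_mul_single (stable_swap hr)) hc]⟩

theorem symmetrizer_mul_mul (g : Perm α) :
    ∃ t : ℂ, (rowSum row * colSum col) * single g 1 * (rowSum row * colSum col)
      = t • (rowSum row * colSum col) := by
  choose t ht using h.rowSum_mul_single_mul_colSum
  set x := colSum col * single g 1 * rowSum row with hx
  refine ⟨∑ k, x.coeff k * t k, ?_⟩
  have e : (rowSum row * colSum col) * single g 1 * (rowSum row * colSum col)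
      = rowSum row * x * colSum col := by
    rw [hx]
    simp only [mul_assoc]
  rw [e]
  conv_lhs => rw [x.eq_sum_single]
  rw [Finset.mul_sum, Finset.sum_mul, Finset.sum_smul]
  refine Finset.sum_congr rfl fun k _ => ?_
  rw [mul_smul_comm, smul_mul_assoc, ht, smul_smul]

theorem eq_one_of_stable {g : Perm α} (hr : ∀ i, row (g i) = row i) (hc : ∀ i, col (g i) = col i) :
    g = 1 :=
  Equiv.ext fun i => h.inj _ _ (hr i) (hc i)

end IsTwoRowsFilling

theorem coeff_mul_colSum (x : MonoidAlgebra ℂ (Perm α)) (col : α → ℕ) (g : Perm α) :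
    (x * colSum col).coeff g = ∑ q : Perm α,
      if ∀ i, col (q i) = col i then x.coeff (g * q⁻¹) * ((sign q : ℤ) : ℂ) else 0 := by
  unfold colSum
  rw [Finset.mul_sum, MonoidAlgebra.coeff_sum, Finsupp.finsetSum_apply, Finset.sum_filter]
  simp

theorem exists_coeff_symmetrizer_eq (row col : α → ℕ) (g : Perm α) :
    ∃ r : ℝ, (rowSum row * colSum col).coeff g = r := by
  have hterm : ∀ q : Perm α, ∃ r : ℝ, (if ∀ i, col (q i) = col i then
      (rowSum row).coeff (g * q⁻¹) * ((sign q : ℤ) : ℂ) else 0) = r := by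
    intro q
    rw [coeff_rowSum]
    split_ifs
    · exact ⟨((sign q : ℤ) : ℝ), by simp⟩
    · exact ⟨0, by simp⟩
    · exact ⟨0, by simp⟩
  choose r hr using hterm
  exact ⟨∑ q, r q, by rw [coeff_mul_colSum, Finset.sum_congr rfl fun q _ => hr q,
    Complex.ofReal_sum]⟩

/-- The decomposition into the first row, the second row, and the boxes below. -/
def rowDecomp (row : α → ℕ) (i : α) : Fin 3 := if row i = 0 then 2 else if row i = 1 then 1 else 0

theorem decompSum_comp (d : α → Fin 3) (s : Perm α) :
    decompSum (d ∘ s) * single s⁻¹ 1 = single s⁻¹ 1 * decompSum d := by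
  ext g
  rw [coeff_mul_single_apply, coeff_single_mul_apply, one_mul, mul_one, coeff_decompSum,
    coeff_decompSum, ← sgnOn_comp s (g := s⁻¹⁻¹ * g)]
  simp

namespace IsTwoRowsFilling

variable {row col : α → ℕ} {a c v : ℕ} (h : IsTwoRowsFilling row col a c v)
include h

theorem coeff_symmetrizer_one : (rowSum row * colSum col).coeff 1 = 1 := by
  rw [coeff_mul_colSum, Finset.sum_eq_single 1]
  · simp [coeff_rowSum]
  · intro q _ hq
    split_ifs with hqc
    · rw [one_mul, coeff_rowSum, if_neg, zero_mul]
      intro hr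
      refine hq (h.eq_one_of_stable (fun i => ?_) hqc)
      simpa using stable_inv hr i
    · rfl
  · simp

theorem fiberSize_rowDecomp : fiberSize (rowDecomp row) = ![v, c + 1, a] := by
  funext i
  unfold fiberSize rowDecomp
  fin_cases i
  · simp only [Fin.zero_eta, Matrix.cons_val]
    rw [← h.card_two_le_row]
    congr 1
    ext i
    simp only [mem_filter, mem_univ, true_and]
    split_ifs <;> simp <;> omega
  · simp only [Fin.mk_one, Matrix.cons_val]
    rw [← h.card_row_one]
    congr 1
    ext i
    simp only [mem_filter, mem_univ, true_and]
    split_ifs <;> simp <;> omega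
  · simp only [Fin.reduceFinMk, Matrix.cons_val]
    rw [← h.card_row_zero]
    congr 1
    ext i
    simp only [mem_filter, mem_univ, true_and]
    split_ifs <;> simp <;> omega

theorem card_eq : a + c + v + 1 = Fintype.card α := by
  rw [← sum_fiberSize (rowDecomp row), h.fiberSize_rowDecomp, Fin.sum_univ_three]
  simp only [Matrix.cons_val]
  ring

/-- Each row below the second is a single box, so row-preserving permutations are trivial on part 0
and are absorbed with sign 1. -/
theorem decompSum_rowDecomp_mul :
    ∃ t : ℂ, t ≠ 0 ∧ decompSum (rowDecomp row) * rowSum row = t • decompSum (rowDecomp row) := by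
  refine ⟨(#{g : Perm α | ∀ i, row (g i) = row i} : ℕ), ?_, ?_⟩
  · rw [Nat.cast_ne_zero, Finset.card_ne_zero]
    exact ⟨1, by simp⟩
  · rw [rowSum, Finset.mul_sum, Finset.sum_congr rfl (g := fun _ => decompSum (rowDecomp row)),
      Finset.sum_const, Nat.cast_smul_eq_nsmul]
    intro g hg
    have hg' := (mem_filter.1 hg).2
    have hst : ∀ i, rowDecomp row (g i) = rowDecomp row i := fun i => by
      unfold rowDecomp
      rw [hg']
    rw [decompSum_mul_single hst, sgnOn_eq_one hst, Int.cast_one, one_smul]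
    intro i hi
    have h1 := h.cell i
    have h2 := h.cell (g i)
    have h3 := hg' i
    have h4 : row i ≠ 0 ∧ row i ≠ 1 := by
      unfold rowDecomp at hi
      split_ifs at hi
      · simp at hi
      · simp at hi
      · tauto
    exact h.inj _ _ h3 (by omega)

/-- The coefficient at 1 does not cancel: a column-preserving `q` that preserves the decomposition
fixes the first two rows pointwise, so its two signs agree and every nonzero term is 1. -/
theorem decompSum_rowDecomp_mul_ne_zero :
    decompSum (rowDecomp row) * (rowSum row * colSum col) ≠ 0 := by
  obtain ⟨t, ht, e⟩ := h.decompSum_rowDecomp_mul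
  rw [← mul_assoc, e, smul_mul_assoc]
  refine smul_ne_zero ht fun h0 => ?_
  have h1 := congrArg (fun x => x.coeff 1) h0
  simp only [MonoidAlgebra.coeff_zero, Finsupp.coe_zero, Pi.zero_apply] at h1
  rw [coeff_mul_colSum] at h1
  have h2 : ∀ q : Perm α, (if ∀ i, col (q i) = col i then
      (decompSum (rowDecomp row)).coeff (1 * q⁻¹) * ((sign q : ℤ) : ℂ) else 0)
      = if (∀ i, col (q i) = col i) ∧ ∀ i, rowDecomp row (q i) = rowDecomp row i then 1 else 0 := by
    intro q
    by_cases hq : ∀ i, col (q i) = col i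
    · rw [if_pos hq, one_mul, coeff_decompSum]
      by_cases hd : ∀ i, rowDecomp row (q i) = rowDecomp row i
      · rw [if_pos ⟨hq, hd⟩, sgnOn_eq_sign (stable_inv hd), sign_inv, ← Int.cast_mul,
          ← Units.val_mul, Int.units_mul_self, Units.val_one, Int.cast_one]
        intro i hi
        by_contra h0
        refine hi (h.inj _ _ ?_ (stable_inv hq i))
        have h3 := stable_inv hd i
        unfold rowDecomp at h3 h0
        split_ifs at h3 h0 <;> omega
      · rw [if_neg (by tauto), sgnOn_of_not_stable]
        · simp
        · intro hd'
          exact hd fun i => by simpa using stable_inv hd' i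
    · rw [if_neg hq, if_neg (by tauto)]
  rw [Finset.sum_congr rfl fun q _ => h2 q, Finset.sum_boole, Nat.cast_eq_zero,
    Finset.card_eq_zero] at h1
  have : (1 : Perm α) ∈ (∅ : Finset (Perm α)) := by
    rw [← h1]
    simp
  simp at this

theorem idealTrace_decompSum_eq_zero {d : α → Fin 3} (hd : ∀ g : Perm α, ∃ u w, u ≠ w ∧
    d u = d w ∧ d u ≠ 0 ∧ col (g⁻¹ u) = col (g⁻¹ w)) :
    idealTrace (rowSum row * colSum col) (decompSum d) = 0 := by
  have key : ∀ x : MonoidAlgebra ℂ (Perm α), decompSum d * x * colSum col = 0 := by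
    intro x
    rw [x.eq_sum_single, Finset.mul_sum, Finset.sum_mul]
    refine Finset.sum_eq_zero fun g _ => ?_
    obtain ⟨u, w, hne, huw, h0, hc⟩ := hd g
    rw [mul_smul_comm, smul_mul_assoc, mul_single_mul_colSum_eq_zero hne _ hc, smul_zero]
    rw [decompSum_mul_single (stable_swap huw), sgnOn_swap_of_ne huw h0, Int.cast_one, one_smul]
  refine idealTrace_eq_zero fun g => ?_
  have := key (single g 1 * rowSum row)
  simpa only [mul_assoc] using this

/-- Pigeonhole in column 0: of its v + 2 boxes at most `fiberSize d 0` lie in part 0, so two share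
another part. -/
theorem idealTrace_decompSum_eq_zero_of_lt {d : α → Fin 3} (hd : fiberSize d 0 < v) :
    idealTrace (rowSum row * colSum col) (decompSum d) = 0 := by
  refine h.idealTrace_decompSum_eq_zero fun g => ?_
  by_contra hcon
  push Not at hcon
  have h1 : #{u | col (g⁻¹ u) = 0} = v + 2 := by
    rw [← h.card_col_zero]
    refine Finset.card_nbij' g.symm g ?_ ?_ ?_ ?_ <;>
      simp [Set.MapsTo, Set.LeftInvOn, Set.RightInvOn]
  have h2 : ∀ j, j ≠ 0 → #{u ∈ univ.filter (fun u => col (g⁻¹ u) = 0) | d u = j} ≤ 1 := by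
    intro j hj
    rw [Finset.card_le_one]
    intro u hu w hw
    simp only [mem_filter, mem_univ, true_and] at hu hw
    by_contra hne
    exact hcon u w hne (hu.2.trans hw.2.symm) (hu.2 ▸ hj) (hu.1.trans hw.1.symm)
  have h3 : #{u ∈ univ.filter (fun u => col (g⁻¹ u) = 0) | d u = 0} ≤ fiberSize d 0 :=
    Finset.card_le_card fun u hu => by
      simp only [mem_filter, mem_univ, true_and] at hu ⊢
      exact hu.2
  have h4 := Finset.card_eq_sum_card_fiberwise (f := d) (t := univ)
    (s := univ.filter fun u => col (g⁻¹ u) = 0) (by simp)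
  rw [Fin.sum_univ_three, h1] at h4
  have := h2 1 (by decide)
  have := h2 2 (by decide)
  omega

/-- Pigeonhole: there are only `a` columns. -/
theorem idealTrace_decompSum_eq_zero_of_gt {d : α → Fin 3} (hd : a < fiberSize d 1) :
    idealTrace (rowSum row * colSum col) (decompSum d) = 0 := by
  refine h.idealTrace_decompSum_eq_zero fun g => ?_
  obtain ⟨u, hu, w, hw, hne, huw⟩ := Finset.exists_ne_map_eq_of_card_lt_of_maps_to
    (s := univ.filter fun u => d u = 1) (t := range a) (f := fun u => col (g⁻¹ u))
    (by rw [card_range]; exact hd) (fun u _ => by simpa using h.col_lt _)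
  simp only [mem_filter, mem_univ, true_and] at hu hw
  exact ⟨u, w, hne, hu.trans hw.symm, by rw [hu]; decide, huw⟩

theorem exists_idealTrace_decompSum {d : α → Fin 3} (hd : fiberSize d = ![v, c + 1, a]) :
    ∃ r : ℕ, 1 ≤ r ∧ idealTrace (rowSum row * colSum col) (decompSum d)
      = (#{g : Perm α | ∀ x, d (g x) = d x} : ℕ) * r := by
  refine exists_idealTrace_eq ?_ (decompSum_mul_self d) ?_
  · rw [Nat.cast_ne_zero, Finset.card_ne_zero]
    exact ⟨1, by simp⟩
  · obtain ⟨s, hs⟩ := exists_perm_comp_eq (h.fiberSize_rowDecomp.trans hd.symm)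
    have hs' : d = rowDecomp row ∘ s := funext fun x => (hs x).symm
    refine ⟨single s⁻¹ 1, fun h0 => h.decompSum_rowDecomp_mul_ne_zero ?_⟩
    rw [hs', decompSum_comp, mul_assoc] at h0
    have := congrArg (fun x => single s 1 * x) h0
    simpa [← mul_assoc, single_mul_single, ← MonoidAlgebra.one_def] using this

theorem sum_signedCount_mul_idealTrace (p q r : ℕ) :
    ∑ g : Perm α, (signedCount g p q r : ℂ) * idealTrace (rowSum row * colSum col) (single g 1)
      = ∑ d : α → Fin 3 with fiberSize d 0 = p ∧ fiberSize d 1 = q ∧ fiberSize d 2 = r,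
          (-1) ^ p * idealTrace (rowSum row * colSum col) (decompSum d) := by
  unfold signedCount
  push_cast
  simp_rw [Finset.sum_mul]
  rw [Finset.sum_comm]
  refine Finset.sum_congr rfl fun d _ => ?_
  rw [idealTrace_eq_sum _ (decompSum d), Finset.mul_sum]
  refine Finset.sum_congr rfl fun g _ => ?_
  rw [coeff_decompSum]
  ring

/-- In `twoRowsFun_eq` every term dies by one of the two pigeonhole lemmas, except the one with
sizes (v, c + 1, a), which enters with sign +1. Each of its decompositions contributes at least the
order of its stabilizer, and these orders add up to n!. -/
theorem sum_twoRowsFun_mul_idealTrace :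
    ∃ m : ℕ, (Fintype.card α).factorial ≤ m ∧
      ∑ g : Perm α, (twoRowsFun g a c v : ℂ)
        * idealTrace (rowSum row * colSum col) (single g 1) = m := by
  have hexists : ∀ d : α → Fin 3, ∃ r : ℕ, fiberSize d = ![v, c + 1, a] → 1 ≤ r ∧
      idealTrace (rowSum row * colSum col) (decompSum d)
        = (#{g : Perm α | ∀ x, d (g x) = d x} : ℕ) * r := by
    intro d
    by_cases hd : fiberSize d = ![v, c + 1, a]
    · obtain ⟨r, hr⟩ := h.exists_idealTrace_decompSum hd
      exact ⟨r, fun _ => hr⟩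
    · exact ⟨0, fun hd' => absurd hd' hd⟩
  choose r hr using hexists
  have hcard := h.card_eq
  refine ⟨∑ d : α → Fin 3 with fiberSize d = ![v, c + 1, a],
    #{g : Perm α | ∀ x, d (g x) = d x} * r d, ?_, ?_⟩
  · rw [← sum_card_stabilizer ![v, c + 1, a] (by rw [Fin.sum_univ_three]; simp; omega)]
    exact Finset.sum_le_sum fun d hd => Nat.le_mul_of_pos_right _ (hr d (mem_filter.1 hd).2).1
  · have e1 : ∀ i ∈ range (v + 1), ∑ g : Perm α, (signedCount g i (a + v + 1 - i) c : ℂ)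
        * idealTrace (rowSum row * colSum col) (single g 1) = 0 := by
      intro i hi
      rw [mem_range] at hi
      rw [h.sum_signedCount_mul_idealTrace]
      refine Finset.sum_eq_zero fun d hd => ?_
      have hd' := (mem_filter.1 hd).2
      rcases Nat.lt_succ_iff_lt_or_eq.1 hi with hi | rfl
      · rw [h.idealTrace_decompSum_eq_zero_of_lt (by omega), mul_zero]
      · rw [h.idealTrace_decompSum_eq_zero_of_gt (by omega), mul_zero]
    have e2 : ∀ i ∈ range v, ∑ g : Perm α, (signedCount g i (c + v + 1 - i) a : ℂ)
        * idealTrace (rowSum row * colSum col) (single g 1) = 0 := by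
      intro i hi
      rw [mem_range] at hi
      rw [h.sum_signedCount_mul_idealTrace]
      refine Finset.sum_eq_zero fun d hd => ?_
      have hd' := (mem_filter.1 hd).2
      rw [h.idealTrace_decompSum_eq_zero_of_lt (by omega), mul_zero]
    have e3 : ∑ g : Perm α, (twoRowsFun g a c v : ℂ)
          * idealTrace (rowSum row * colSum col) (single g 1)
        = (-1) ^ (v + 1) * (∑ i ∈ range (v + 1), ∑ g : Perm α,
            (signedCount g i (a + v + 1 - i) c : ℂ)
              * idealTrace (rowSum row * colSum col) (single g 1)
          - ∑ i ∈ range (v + 1), ∑ g : Perm α, (signedCount g i (c + v + 1 - i) a : ℂ)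
              * idealTrace (rowSum row * colSum col) (single g 1)) := by
      rw [Finset.sum_comm, Finset.sum_comm (s := range (v + 1)), ← Finset.sum_sub_distrib,
        Finset.mul_sum]
      refine Finset.sum_congr rfl fun g _ => ?_
      rw [twoRowsFun_eq]
      push_cast
      rw [Finset.sum_sub_distrib, ← Finset.sum_mul, ← Finset.sum_mul]
      ring
    rw [e3, Finset.sum_eq_zero e1, Finset.sum_range_succ, Finset.sum_eq_zero e2, zero_add, zero_sub,
      h.sum_signedCount_mul_idealTrace, ← Finset.mul_sum, mul_neg, ← mul_assoc, ← pow_add,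
      show v + 1 + v = 2 * v + 1 by ring, pow_succ, pow_mul]
    push_cast
    simp only [even_two, Even.neg_pow, one_pow, one_mul, neg_mul, neg_neg]
    refine Finset.sum_congr (Finset.filter_congr fun d _ => ?_) fun d hd => ?_
    · rw [show c + v + 1 - v = c + 1 by omega, funext_iff, Fin.forall_fin_succ,
        Fin.forall_fin_succ, Fin.forall_fin_succ]
      simp
    · exact (hr d (mem_filter.1 hd).2).2

theorem idealTrace_eq (g : Perm α) :
    idealTrace (rowSum row * colSum col) (single g 1) = twoRowsFun g a c v := by
  obtain ⟨m, hm, e⟩ := h.sum_twoRowsFun_mul_idealTrace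
  have := idealTrace_eq_of_inner (c := rowSum row * colSum col)
    (fun g : Perm α => isConj_iff_cycleType_eq.2 (cycleType_inv g).symm) h.symmetrizer_mul_mul
    h.coeff_symmetrizer_one (exists_coeff_symmetrizer_eq row col)
    (fun g => (twoRowsFun g a c v : ℝ)) ?_ ⟨m, ?_, ?_⟩ g
  · simpa using this
  · rw [Fintype.card_perm]
    exact_mod_cast sum_twoRowsFun_sq (α := α) h.card_eq h.lt
  · rw [Fintype.card_perm]
    exact_mod_cast hm
  · simpa using e

end IsTwoRowsFilling

end YoungSymmetrizer

/-! ### Back to partitions and polynomials. -/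

section Assembly

open Finset

theorem Nat.Partition.rowSymmetrizer_eq {n : ℕ} (l : n.Partition) :
    l.rowSymmetrizer = rowSum fun i => (l.tableau i).1.1 := by
  unfold Nat.Partition.rowSymmetrizer rowSum
  congr!

theorem Nat.Partition.colAntisymmetrizer_eq {n : ℕ} (l : n.Partition) :
    l.colAntisymmetrizer = colSum fun i => (l.tableau i).1.2 := by
  unfold Nat.Partition.colAntisymmetrizer colSum
  congr!

theorem Nat.Partition.permChar_eq {n : ℕ} (l : n.Partition) (g : Equiv.Perm (Fin n)) :
    l.permChar g = idealTrace (rowSum (fun i => (l.tableau i).1.1)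
      * colSum (fun i => (l.tableau i).1.2)) (MonoidAlgebra.single g 1) := by
  rw [← l.rowSymmetrizer_eq, ← l.colAntisymmetrizer_eq]
  exact trace_ofModule' _ g

theorem Nat.Partition.exists_tableau_iff {n : ℕ} (l : n.Partition) (r s : ℕ) :
    (∃ i, (l.tableau i).1.1 = r ∧ (l.tableau i).1.2 = s)
      ↔ ∃ h : r < (l.parts.sort (· ≥ ·)).length, s < (l.parts.sort (· ≥ ·))[r] := by
  have h1 : (r, s) ∈ l.diagram ↔ ∃ h : r < (l.parts.sort (· ≥ ·)).length,
      s < (l.parts.sort (· ≥ ·))[r] := YoungDiagram.mem_ofRowLens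
  rw [← h1]
  constructor
  · rintro ⟨i, rfl, rfl⟩
    exact (l.tableau i).2
  · intro h
    exact ⟨l.tableau.symm ⟨(r, s), h⟩, by simp, by simp⟩

theorem Nat.Partition.tableau_inj {n : ℕ} (l : n.Partition) (i j : Fin n)
    (hr : (l.tableau i).1.1 = (l.tableau j).1.1) (hc : (l.tableau i).1.2 = (l.tableau j).1.2) :
    i = j :=
  l.tableau.injective (Subtype.ext (Prod.ext hr hc))

theorem Multiset.sort_two_cons_replicate {a b v : ℕ} (hab : b ≤ a) (hb : 1 ≤ b) :
    (a ::ₘ b ::ₘ Multiset.replicate v 1).sort (· ≥ ·) = a :: b :: List.replicate v 1 := by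
  rw [Multiset.sort_cons, Multiset.sort_cons]
  · congr 2
    rw [List.eq_replicate_iff]
    refine ⟨by rw [Multiset.length_sort, Multiset.card_replicate], fun x hx => ?_⟩
    rw [Multiset.mem_sort] at hx
    exact Multiset.eq_of_mem_replicate hx
  · intro x hx
    rw [Multiset.eq_of_mem_replicate hx]
    exact hb
  · intro x hx
    rcases Multiset.mem_cons.1 hx with rfl | hx
    · exact hab
    · rw [Multiset.eq_of_mem_replicate hx]
      exact hb.trans hab

theorem nthPart_one_le {n : ℕ} (l : n.Partition) : l.nthPart 1 ≤ l.nthPart 0 := by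
  unfold Nat.Partition.nthPart
  have := Multiset.pairwise_sort l.parts (· ≥ ·)
  generalize l.parts.sort (· ≥ ·) = w at this ⊢
  rcases w with _ | ⟨x, _ | ⟨y, w⟩⟩
  · simp
  · simp
  · simp at this
    simpa using this.1.1

theorem mem_twoRowsOnes {n : ℕ} {l : n.Partition} :
    l ∈ twoRowsOnes n ↔ 1 ≤ l.nthPart 1 ∧
      l.parts = l.nthPart 0 ::ₘ l.nthPart 1 ::ₘ Multiset.replicate (l.parts.card - 2) 1 := by
  simp [twoRowsOnes]

theorem isTwoRowsFilling_tableau {n : ℕ} {l : n.Partition} (hl : l ∈ twoRowsOnes n) :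
    IsTwoRowsFilling (fun i => (l.tableau i).1.1) (fun i => (l.tableau i).1.2)
      (l.nthPart 0) (l.nthPart 1 - 1) (l.parts.card - 2) := by
  obtain ⟨h1, h2⟩ := mem_twoRowsOnes.1 hl
  have h3 := nthPart_one_le l
  refine ⟨by omega, l.tableau_inj, fun r s => ?_⟩
  rw [l.exists_tableau_iff]
  have h4 : l.parts.sort (· ≥ ·)
      = l.nthPart 0 :: l.nthPart 1 :: List.replicate (l.parts.card - 2) 1 := by
    conv_lhs => rw [h2]
    exact Multiset.sort_two_cons_replicate h3 h1
  rw [h4]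
  generalize l.nthPart 0 = a at *
  generalize l.nthPart 1 = b at *
  rcases r with _ | _ | r
  · simp
  · simp
    omega
  · simp

theorem permChar_of_mem_twoRowsOnes {n : ℕ} {l : n.Partition} (hl : l ∈ twoRowsOnes n)
    (g : Equiv.Perm (Fin n)) :
    l.permChar g = twoRowsFun g (l.nthPart 0) (l.nthPart 1 - 1) (l.parts.card - 2) := by
  rw [l.permChar_eq, (isTwoRowsFilling_tableau hl).idealTrace_eq]

/-- With a single row the column sum is 1 and the symmetrizer is the sum of all group elements. -/
theorem permChar_indiscrete {n : ℕ} (hn : n ≠ 0) (g : Equiv.Perm (Fin n)) :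
    (Nat.Partition.indiscrete n).permChar g = 1 := by
  set l := Nat.Partition.indiscrete n
  have hs : l.parts.sort (· ≥ ·) = [n] := by
    rw [Nat.Partition.indiscrete_parts hn, Multiset.sort_singleton]
  have hrow : ∀ i, (l.tableau i).1.1 = 0 := by
    intro i
    obtain ⟨h, -⟩ := (l.exists_tableau_iff (l.tableau i).1.1 (l.tableau i).1.2).1 ⟨i, rfl, rfl⟩
    rw [hs] at h
    simpa using h
  have hrs : ∀ k, (rowSum fun i => (l.tableau i).1.1).coeff k = 1 := fun k => by
    simp [coeff_rowSum, hrow]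
  have hcol : colSum (fun i => (l.tableau i).1.2) = 1 := by
    ext k
    rw [coeff_colSum, MonoidAlgebra.one_def, MonoidAlgebra.coeff_single, Finsupp.single_apply]
    by_cases hk : 1 = k
    · subst hk
      simp
    · rw [if_neg hk, if_neg]
      intro hc
      refine hk (Equiv.ext fun i => ?_)
      exact (l.tableau_inj _ _ (by rw [hrow, hrow]) (hc i)).symm
  rw [l.permChar_eq, hcol, mul_one]
  set c := rowSum fun i => (l.tableau i).1.1
  have hcc : c * c = (Fintype.card (Equiv.Perm (Fin n)) : ℂ) • c := by
    conv_lhs => arg 1; rw [c.eq_sum_single]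
    rw [Finset.sum_mul]
    rw [← Finset.card_univ, Nat.cast_smul_eq_nsmul, ← Finset.sum_const]
    refine Finset.sum_congr rfl fun k _ => ?_
    rw [hrs, one_smul]
    ext x
    rw [MonoidAlgebra.coeff_single_mul_apply, hrs, hrs, mul_one]
  rw [idealTrace_single (by simp) hcc]
  simp [hrs]

theorem sum_twoRowsOnes {n : ℕ} (T : ℕ → ℕ → ℕ → ℂ) :
    ∑ l ∈ twoRowsOnes n, T (l.nthPart 0) (l.nthPart 1 - 1) (l.parts.card - 2)
      = ∑ t ∈ triples n with t.2.1 < t.1, T t.1 t.2.1 t.2.2 := by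
  refine Finset.sum_bij (fun l _ => (l.nthPart 0, l.nthPart 1 - 1, l.parts.card - 2)) ?_ ?_ ?_ ?_
  · intro l hl
    have h1 := (isTwoRowsFilling_tableau hl).card_eq
    have h2 := (isTwoRowsFilling_tableau hl).lt
    rw [Fintype.card_fin] at h1
    rw [mem_filter, mem_triples]
    exact ⟨h1, h2⟩
  · intro l hl l' hl' h
    obtain ⟨h1, h2⟩ := mem_twoRowsOnes.1 hl
    obtain ⟨h1', h2'⟩ := mem_twoRowsOnes.1 hl'
    simp only [Prod.mk.injEq] at h
    refine Nat.Partition.ext ?_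
    rw [h2, h2', h.1, h.2.2, show l.nthPart 1 = l'.nthPart 1 by omega]
  · rintro ⟨a, c, v⟩ ht
    rw [mem_filter, mem_triples] at ht
    dsimp only at ht
    let l : n.Partition :=
      { parts := a ::ₘ (c + 1) ::ₘ Multiset.replicate v 1
        parts_pos := by
          intro i hi
          rcases Multiset.mem_cons.1 hi with rfl | hi
          · omega
          rcases Multiset.mem_cons.1 hi with rfl | hi
          · omega
          · rw [Multiset.eq_of_mem_replicate hi]
            exact one_pos
        parts_sum := by
          simp
          omega }
    have hs : l.parts.sort (· ≥ ·) = a :: (c + 1) :: List.replicate v 1 :=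
      Multiset.sort_two_cons_replicate (by omega) (by omega)
    have h0 : l.nthPart 0 = a := by simp [Nat.Partition.nthPart, hs]
    have h1 : l.nthPart 1 = c + 1 := by simp [Nat.Partition.nthPart, hs]
    have hc : l.parts.card - 2 = v := by simp [l]
    refine ⟨l, ?_, ?_⟩
    · rw [mem_twoRowsOnes, h0, h1, hc]
      exact ⟨by omega, rfl⟩
    · rw [h0, h1, hc]
      rfl
  · intro l hl
    rfl

theorem card_parts_eq_sum_permChar {n : ℕ} (g : Equiv.Perm (Fin n)) :
    (g.partition.parts.card : ℂ) = ((harmonic n : ℚ) : ℂ) * (Nat.Partition.indiscrete n).permChar g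
      + ∑ l ∈ twoRowsOnes n, (-1 : ℂ) ^ (l.parts.card - 2)
          * (1 / ((l.nthPart 1 : ℂ) + ((l.parts.card - 2 : ℕ) : ℂ))
            - 1 / ((l.nthPart 0 : ℂ) + ((l.parts.card - 2 : ℕ) : ℂ) + 1)) * l.permChar g := by
  have h1 : ((harmonic n : ℚ) : ℂ) * (Nat.Partition.indiscrete n).permChar g
      = ((harmonic n : ℚ) : ℂ) := by
    -- For n = 0 the harmonic number is 0, so the value of the character does not matter.
    by_cases hn : n = 0
    · subst hn
      simp
    · rw [permChar_indiscrete hn, mul_one]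
  obtain ⟨T, hT⟩ : ∃ T : ℕ → ℕ → ℕ → ℂ, ∀ a c v, T a c v = (-1 : ℂ) ^ v
      * (1 / ((c : ℂ) + 1 + v) - 1 / ((a : ℂ) + v + 1)) * twoRowsFun g a c v :=
    ⟨_, fun _ _ _ => rfl⟩
  have h2 : ∀ l ∈ twoRowsOnes n, (-1 : ℂ) ^ (l.parts.card - 2)
          * (1 / ((l.nthPart 1 : ℂ) + ((l.parts.card - 2 : ℕ) : ℂ))
            - 1 / ((l.nthPart 0 : ℂ) + ((l.parts.card - 2 : ℕ) : ℂ) + 1)) * l.permChar g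
      = T (l.nthPart 0) (l.nthPart 1 - 1) (l.parts.card - 2) := by
    intro l hl
    have h3 : ((l.nthPart 1 - 1 : ℕ) : ℂ) + 1 = l.nthPart 1 := by
      have := (mem_twoRowsOnes.1 hl).1
      rw [← Nat.cast_add_one, Nat.sub_add_cancel this]
    rw [permChar_of_mem_twoRowsOnes hl, hT, h3]
  rw [h1, Finset.sum_congr rfl h2, sum_twoRowsOnes]
  simp only [hT]
  have h4 := congrArg (Rat.cast (K := ℂ)) (card_parts_eq g (Fintype.card_fin n))
  push_cast at h4
  exact h4

open Classical in
theorem omega_eq_card_factorizationType {F : Type*} [Field F] {n : ℕ} {f : F[X]}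
    (hf : f.natDegree = n ∧ Squarefree f) : f.omega = (f.factorizationType hf).parts.card := by
  have h0 : f ≠ 0 := hf.2.ne_zero
  have hset : {P : F[X] | P.Monic ∧ Irreducible P ∧ P ∣ f}
      = ((UniqueFactorizationMonoid.normalizedFactors f).toFinset : Set F[X]) := by
    ext P
    simp only [Set.mem_ofPred_eq, Finset.mem_coe, Multiset.mem_toFinset,
      UniqueFactorizationMonoid.mem_normalizedFactors_iff' h0]
    constructor
    · rintro ⟨h1, h2, h3⟩
      exact ⟨h2, h1.normalize_eq_self, h3⟩
    · rintro ⟨h1, h2, h3⟩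
      exact ⟨h2 ▸ monic_normalize h1.ne_zero, h1, h3⟩
  unfold Polynomial.omega Polynomial.factorizationType
  rw [hset, Set.ncard_coe_finset, Multiset.toFinset_card_of_nodup
    ((UniqueFactorizationMonoid.squarefree_iff_nodup_normalizedFactors h0).1 hf.2),
    Multiset.card_map]

end Assembly

theorem mainTheorem11 (F : Type*) [Field F] [Finite F] :
    ∃ b : F[X] → ℂ,
      (∀ f : F[X], b f ≠ 0 → ¬ Squarefree f) ∧
      ∀ (n : ℕ) (f : F[X]), f.Monic → f.natDegree = n →
        (f.omega : ℂ) =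
          ((harmonic n : ℚ) : ℂ) * (Nat.Partition.indiscrete n).polyChar f
          + ∑ l ∈ twoRowsOnes n,
              (-1 : ℂ) ^ (l.parts.card - 2)
                * (1 / ((l.nthPart 1 : ℂ) + ((l.parts.card - 2 : ℕ) : ℂ))
                    - 1 / ((l.nthPart 0 : ℂ) + ((l.parts.card - 2 : ℕ) : ℂ) + 1))
                * l.polyChar f
          + b f := by
  classical
  -- On a non-squarefree `f` every `polyChar` vanishes, so `b` has to be ω itself.
  refine ⟨fun f => if Squarefree f then 0 else (f.omega : ℂ), fun f hb hf => hb (if_pos hf), ?_⟩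
  intro n f _ hn
  by_cases hf : Squarefree f
  · have hfn : f.natDegree = n ∧ Squarefree f := ⟨hn, hf⟩
    have hpoly : ∀ l : n.Partition, l.polyChar f
        = l.permChar (f.factorizationType hfn).exists_perm.choose := fun l => dif_pos hfn
    simp only [hpoly, if_pos hf, add_zero]
    rw [omega_eq_card_factorizationType hfn, ← card_parts_eq_sum_permChar,
      (f.factorizationType hfn).exists_perm.choose_spec]
  · have hpoly : ∀ l : n.Partition, l.polyChar f = 0 := fun l => dif_neg fun h => hf h.2
    simp [hpoly, if_neg hf]
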